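/- Let $\mathbb{F}_q$ be a finite field with $q$ elements, $A=\mathbb{F}_q[\theta]$, $K_\infty=\mathbb{F}_q((1/\theta))$ with $|\theta|=q$, $\mathbb{C}_\infty$ the completion of an algebraic closure of $K_\infty$, and $\Omega=\mathbb{C}_\infty\setminus K_\infty$, with $|z|_i=\inf_{x\in K_\infty}|z-x|$. Let $e_C(z)=\sum_{i\ge 0} z^{q^i}/D_i$ be the Carlitz exponential, where $D_0=1$ and $D_i=(\theta^{q^i}-\theta)D_{i-1}^q$; let $\tilde\pi=\theta\rho\prod_{i\ge1}(1-\theta^{1-q^i})^{-1}$ be the Carlitz period, for a fixed $\rho \in \mathbb{C}_\infty$ with $\rho^{q-1}=-\theta$; and put $u(z)=1/e_C(\tilde\pi z)$ for $z\in\Omega$. Let $\mathcal{U}(\Omega)$ be the set of rigid analytic functions $f:\Omega\to\mathbb{C}_\infty$ such that $f(z+a)=f(z)$ for all $a\in A$ and $f(z)=\sum_{n\ge0}c_nu(z)^n$ (a convergent series) for all $z$ with $|z|_i$ sufficiently large; the power series $\sum c_nu^n\in\mathbb{C}_\infty[[u]]$ is then uniquely determined by $f$, and $f$ is identified with it. For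 $r\ge0$ put $\Theta^r=(-\tilde\pi)^{-r}\partial_z^r$, where the hyperderivative $\partial_z^r(f)(z)$ is the coefficient of $(w-z)^r$ in the Taylor expansion of $f(w)$ at $z\in\Omega$; on Laurent series in $u$ let $\partial_u^j$ be the hyperderivative $\partial_u^j(u^m)=\binom{m}{j}u^{m-j}$, $m\in\mathbb{Z}$. For $k\ge1$ let $G_k(t)$ be the $k$-th Goss polynomial of the lattice $\Lambda_C=A\tilde\pi$, that is, the polynomial with $$\sum_{\lambda\in\Lambda_C}\frac{1}{(z-\lambda)^k}=G_k\left(\frac{1}{e_{\Lambda_C}(z)}\right)\quad(z\in\mathbb{C}_\infty\setminus\Lambda_C),\qquad e_{\Lambda_C}(z)=z\prod_{0\ne\lambda\in\Lambda_C}\left(1-\frac z\lambda\right),$$ and write $G_{r+1}(t)=\sum_{j=0}^r\beta_{r,j}t^{j+1}$. Let $f=\sum_{n\ge0} c_nu^n\in\mathcal{U}(\Omega)$ and $r\ge0$. Then $\Theta^r(f)$ and $\Theta^r(c_0)$ (the operator applied to the constant function $c_0$) lie in $\mathcal{U}(\Omega)$, and their $u$-expansions satisfy $$\Theta^r(f)=\Theta^r(c_0)+\sum_{n=1}^\infty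 c_n\,u^n\,\partial_u^{n-1}\bigl(u^{n-2}G_{r+1}(u)\bigr),$$ $$\Theta^r(f)=\sum_{j=0}^r\beta_{r,j}\,u^{j+1}\,\partial_u^j\bigl(u^{j-1}f\bigr),$$ where the infinite sum converges in the $u$-adic topology. -/

import Mathlib

noncomputable section

namespace CarlitzTheta

open scoped Polynomial PowerSeries LaurentSeries

/-! ## The fields `K_∞ = 𝔽_q((1/θ))` and `ℂ_∞` -/

section Fields

variable (Fq : Type*) [Field Fq] [Fintype Fq]

open Classical in
/-- The completion `K_∞ = 𝔽_q((1/θ))` of `K = 𝔽_q(θ)` at the place at infinity. -/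
abbrev KInf : Type _ := RatFunc.CompletionAtInfty Fq

/-- The number `q` of elements of the constant field. -/
abbrev qCard : ℕ := Fintype.card Fq

lemma one_lt_qCard_nnreal : 1 < (qCard Fq : NNReal) := by
  exact_mod_cast Fintype.one_lt_card (α := Fq)

lemma qCard_nnreal_ne_zero : (qCard Fq : NNReal) ≠ 0 :=
  (lt_trans zero_lt_one (one_lt_qCard_nnreal Fq)).ne'

/-- The image in `K_∞` of a polynomial in `A = 𝔽_q[θ]`. -/
def polyToKInf : Fq[X] →+* KInf Fq :=
  (algebraMap (RatFunc Fq) (KInf Fq)).comp (algebraMap Fq[X] (RatFunc Fq))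

set_option linter.unusedSectionVars false in
open Classical in
lemma valued_polyToKInf_X :
    (Valued.v (polyToKInf Fq Polynomial.X) : WithZero (Multiplicative ℤ)) = WithZero.exp (1 : ℤ) := by
  have h := @Valued.extensionValuation_apply_coe (RatFunc Fq) _ _ _ (RatFunc.inftyValued Fq)
    (algebraMap Fq[X] (RatFunc Fq) Polynomial.X)
  refine h.trans ?_
  rw [RatFunc.algebraMap_X]
  exact RatFunc.inftyValuation.X Fq

open MonoidWithZeroHom.ValueGroup₀ in
/-- The absolute value on `K_∞` is normalised by `|θ|_∞ = q`: a valuation `exp m` is sent to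
`q ^ m`. -/
instance KInf.rankOne :
    (Valued.v : Valuation (KInf Fq) (WithZero (Multiplicative ℤ))).RankOne where
  hom' := (WithZeroMulInt.toNNReal (qCard_nnreal_ne_zero Fq)).comp embedding
  strictMono' :=
    (WithZeroMulInt.toNNReal_strictMono (one_lt_qCard_nnreal Fq)).comp embedding_strictMono
  exists_val_nontrivial := ⟨polyToKInf Fq Polynomial.X, by rw [valued_polyToKInf_X]; simp⟩

/-- `K_∞` as a (nontrivially) normed field, with `‖θ‖ = q`. -/
instance KInf.nontriviallyNormedField : NontriviallyNormedField (KInf Fq) :=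
  Valued.toNontriviallyNormedField (KInf Fq) (WithZero (Multiplicative ℤ))

instance KInf.isUltrametricDist : IsUltrametricDist (KInf Fq) :=
  IsUltrametricDist.isUltrametricDist_of_forall_norm_add_le_max_norm
    (Valued.isNonarchimedean_norm (KInf Fq) (WithZero (Multiplicative ℤ)))

open Classical in
instance KInf.completeSpace : CompleteSpace (KInf Fq) :=
  @UniformSpace.Completion.completeSpace (RatFunc Fq) (RatFunc.inftyValued Fq).toUniformSpace

/-- An algebraic closure of `K_∞`. -/
abbrev KInfAlg : Type _ := AlgebraicClosure (KInf Fq)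

/-- The absolute value of `K_∞` extends uniquely to its algebraic closure. -/
instance KInfAlg.normedField : NormedField (KInfAlg Fq) :=
  spectralNorm.normedField (KInf Fq) (KInfAlg Fq)

/-- The field `ℂ_∞`, the completion of an algebraic closure of `K_∞`. -/
abbrev CInf : Type _ := UniformSpace.Completion (KInfAlg Fq)

/-- The embedding of `K_∞` into `ℂ_∞`. -/
def ofKInf : KInf Fq →+* CInf Fq :=
  (UniformSpace.Completion.coeRingHom).comp (algebraMap (KInf Fq) (KInfAlg Fq))

/-- The embedding of `A = 𝔽_q[θ]` into `ℂ_∞`. -/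
def ofA : Fq[X] →+* CInf Fq := (ofKInf Fq).comp (polyToKInf Fq)

/-- The element `θ` of `ℂ_∞`. -/
def theta : CInf Fq := ofA Fq Polynomial.X

/-- The normalisation of the absolute value: `|θ|_∞ = q`. -/
lemma norm_theta : ‖theta Fq‖ = qCard Fq := by
  have h1 : ‖theta Fq‖ = ‖algebraMap (KInf Fq) (KInfAlg Fq) (polyToKInf Fq Polynomial.X)‖ :=
    UniformSpace.Completion.norm_coe _
  have h2 : ‖algebraMap (KInf Fq) (KInfAlg Fq) (polyToKInf Fq Polynomial.X)‖ = ‖polyToKInf Fq Polynomial.X‖ :=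
    spectralNorm_extends _
  have h3 : ‖polyToKInf Fq Polynomial.X‖ = ((WithZeroMulInt.toNNReal (qCard_nnreal_ne_zero Fq)
      (Valued.v (polyToKInf Fq Polynomial.X)) : NNReal) : ℝ) := by
    change ((WithZeroMulInt.toNNReal (qCard_nnreal_ne_zero Fq)
      (MonoidWithZeroHom.ValueGroup₀.embedding (Valued.v.restrict (polyToKInf Fq Polynomial.X))) :
        NNReal) : ℝ) = _
    rw [Valuation.embedding_restrict]
  rw [h1, h2, h3, valued_polyToKInf_X]
  rw [WithZeroMulInt.toNNReal_neg_apply _ WithZero.exp_ne_zero]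
  change (((qCard Fq : NNReal) ^ (1 : ℤ) : NNReal) : ℝ) = _
  simp

end Fields

/-! ## Discrete subspaces of `ℂ_∞` and Goss polynomials -/

section Goss

variable {Fq : Type*} [Field Fq] [Fintype Fq]

/-- The exponential function `e_Λ(z) = z ∏' (1 - z / λ)` of `Λ ⊆ ℂ_∞`, the product being taken
over the nonzero elements `λ` of `Λ`. -/
def latticeExp (Λ : Set (CInf Fq)) (z : CInf Fq) : CInf Fq :=
  z * ∏' l : {l : CInf Fq // l ∈ Λ ∧ l ≠ 0}, (1 - z / (l : CInf Fq))

/-- The function `t_Λ(z) = 1 / e_Λ(z)`. -/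
def latticeT (Λ : Set (CInf Fq)) (z : CInf Fq) : CInf Fq := 1 / latticeExp Λ z

/-- `G` is a `k`-th Goss polynomial of `Λ`: for all `z ∉ Λ` the series
`S_{k,Λ}(z) = ∑_{λ ∈ Λ} 1 / (z - λ) ^ k` converges to `G(t_Λ(z))`. -/
def IsGossPoly (Λ : Set (CInf Fq)) (k : ℕ) (G : (CInf Fq)[X]) : Prop :=
  ∀ z : CInf Fq, z ∉ Λ →
    HasSum (fun l : Λ => 1 / (z - (l : CInf Fq)) ^ k) (G.eval (latticeT Λ z))

open Classical in
/-- The `k`-th Goss polynomial `G_{k,Λ}(t)`, the polynomial with `S_{k,Λ}(z) = G_{k,Λ}(t_Λ(z))`.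
For an infinite discrete `Λ` there is only one such polynomial, because `t_Λ` takes infinitely many
values. (Junk value `0` if there is none.) -/
def gossPoly (Λ : Set (CInf Fq)) (k : ℕ) : (CInf Fq)[X] :=
  if h : ∃ G, IsGossPoly Λ k G then h.choose else 0

end Goss

/-! ## The Carlitz module -/

section Carlitz

/-- `D_0 = 1` and `D_i = [i] D_{i-1} ^ q`, where `[i] = θ ^ (q ^ i) - θ`. -/
def carlitzD (Fq : Type*) [Field Fq] [Fintype Fq] : ℕ → Fq[X]
  | 0 => 1
  | i + 1 => (Polynomial.X ^ qCard Fq ^ (i + 1) - Polynomial.X) * carlitzD Fq i ^ qCard Fq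

variable {Fq : Type*} [Field Fq] [Fintype Fq]

/-- The Carlitz exponential `e_C(z) = ∑ z ^ (q ^ i) / D_i`. -/
def carlitzExp (z : CInf Fq) : CInf Fq :=
  ∑' i : ℕ, z ^ qCard Fq ^ i / ofA Fq (carlitzD Fq i)

/-- The Carlitz period `θ ρ ∏_{i ≥ 1} (1 - θ ^ (1 - q ^ i))⁻¹` attached to a `(q-1)`-st root `ρ`
of `-θ`. -/
def carlitzPeriod (ρ : CInf Fq) : CInf Fq :=
  theta Fq * ρ *
    ∏' i : ℕ, (1 - theta Fq ^ ((1 : ℤ) - (qCard Fq : ℤ) ^ (i + 1)))⁻¹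

/-- The lattice `Λ_C = A π̃`. -/
def carlitzLattice (ρ : CInf Fq) : Set (CInf Fq) :=
  Set.range fun a : Fq[X] => ofA Fq a * carlitzPeriod ρ

/-- The coefficients `β_{r,j}` of `G_{r+1}(t) = G_{r+1,Λ_C}(t) = ∑_{j ≤ r} β_{r,j} t ^ (j+1)`. -/
def gossCoeff (ρ : CInf Fq) (r j : ℕ) : CInf Fq :=
  (gossPoly (carlitzLattice ρ) (r + 1)).coeff (j + 1)

end Carlitz

/-! ## Functions on the Drinfeld upper half plane -/

section Functions

/-- The Drinfeld upper half plane `Ω = ℂ_∞ \ K_∞`. -/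
def Omega (Fq : Type*) [Field Fq] [Fintype Fq] : Set (CInf Fq) := (Set.range (ofKInf Fq))ᶜ

variable {Fq : Type*} [Field Fq] [Fintype Fq]

/-- The imaginary part `|z|_i = inf_{x ∈ K_∞} |z - x|_∞`. -/
def imagPart (z : CInf Fq) : ℝ := ⨅ x : KInf Fq, ‖z - ofKInf Fq x‖

/-- The standard affinoid subset `Ω_n = {z : |z| ≤ q ^ n, |z|_i ≥ q ^ (-n)}` of `Ω`. The `Ω_n`,
`n ≥ 0`, form an admissible covering of `Ω`. -/
def affinoid (Fq : Type*) [Field Fq] [Fintype Fq] (n : ℕ) : Set (CInf Fq) :=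
  {z | ‖z‖ ≤ (qCard Fq : ℝ) ^ n ∧ ((qCard Fq : ℝ) ^ n)⁻¹ ≤ imagPart z}

/-- `f : Ω → ℂ_∞` is holomorphic (rigid analytic): on each affinoid `Ω_n` it is a uniform limit of
rational functions without poles on `Ω_n`. -/
def IsHolomorphic (f : Omega Fq → CInf Fq) : Prop :=
  ∀ n : ℕ, ∀ ε : ℝ, 0 < ε → ∃ P Q : (CInf Fq)[X],
    (∀ z ∈ affinoid Fq n, Q.eval z ≠ 0) ∧
      ∀ z : Omega Fq, (z : CInf Fq) ∈ affinoid Fq n →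
        ‖f z - P.eval (z : CInf Fq) / Q.eval (z : CInf Fq)‖ ≤ ε

/-- `f(z + a) = f(z)` for all `a ∈ A` and `z ∈ Ω`. -/
def IsAPeriodic (f : Omega Fq → CInf Fq) : Prop :=
  ∀ (a : Fq[X]) (z w : Omega Fq), (w : CInf Fq) = z + ofA Fq a → f w = f z

/-- The parameter at infinity `u(z) = 1 / e_C(π̃ z)`. -/
def uParam (ρ : CInf Fq) (z : Omega Fq) : CInf Fq :=
  1 / carlitzExp (carlitzPeriod ρ * (z : CInf Fq))

/-- `f(z) = ∑ c_n u(z) ^ n` (a convergent series) for `|z|_i ≫ 0`. -/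
def HasUExpansion (ρ : CInf Fq) (f : Omega Fq → CInf Fq) (c : (CInf Fq)⟦X⟧) : Prop :=
  ∃ R : ℝ, ∀ z : Omega Fq, R < imagPart (z : CInf Fq) →
    HasSum (fun n : ℕ => PowerSeries.coeff n c * uParam ρ z ^ n) (f z)

/-- The set `𝒰(Ω)` of holomorphic functions on `Ω` that are `A`-periodic and holomorphic at
infinity. -/
def UOmega (ρ : CInf Fq) : Set (Omega Fq → CInf Fq) :=
  {f | IsHolomorphic f ∧ IsAPeriodic f ∧ ∃ c, HasUExpansion ρ f c}

open Classical in
/-- The `u`-expansion of `f ∈ 𝒰(Ω)`, as a formal power series in `u`. It is unique, because `u` takes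
nonzero values of arbitrarily small absolute value as `|z|_i → ∞`. (Junk value `0` if there is no
`u`-expansion.) -/
def uExp (ρ : CInf Fq) (f : Omega Fq → CInf Fq) : (CInf Fq)⟦X⟧ :=
  if h : ∃ c, HasUExpansion ρ f c then h.choose else 0

/-- `f(w) = ∑ a_j (w - z) ^ j` for all `w` in a neighbourhood of `z ∈ Ω`. -/
def HasTaylor (f : Omega Fq → CInf Fq) (z : Omega Fq) (a : ℕ → CInf Fq) : Prop :=
  ∃ ε : ℝ, 0 < ε ∧ ∀ w : Omega Fq, ‖(w : CInf Fq) - z‖ < ε →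
    HasSum (fun j : ℕ => a j * ((w : CInf Fq) - z) ^ j) (f w)

open Classical in
/-- The hyperderivative `∂_z^r(f)` of a function on `Ω`: its value at `z` is the coefficient of
`(w - z) ^ r` in the Taylor expansion of `f` at `z`. (Junk value `0` if there is no such
expansion.) -/
def hyperDeriv (r : ℕ) (f : Omega Fq → CInf Fq) (z : Omega Fq) : CInf Fq :=
  if h : ∃ a, HasTaylor f z a then h.choose r else 0

/-- The operator `Θ^r = (-π̃)^{-r} ∂_z^r`. -/
def thetaOp (ρ : CInf Fq) (r : ℕ) (f : Omega Fq → CInf Fq) : Omega Fq → CInf Fq :=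
  fun z => 1 / (-carlitzPeriod ρ) ^ r * hyperDeriv r f z

end Functions

/-! ## Formal Laurent series in `u` -/

section Formal

variable {F : Type*} [Field F]

/-- The monomial `u ^ m`, `m ∈ ℤ`, as a formal Laurent series. -/
def uPow (F : Type*) [Field F] (m : ℤ) : F⸨X⸩ := HahnSeries.single m 1

/-- The formal hyperderivative `∂_u^j` on Laurent series, `∂_u^j(u^m) = binom(m, j) u^(m-j)`. -/
def formalHyperDeriv (j : ℕ) : F⸨X⸩ →ₗ[F] F⸨X⸩ := LaurentSeries.hasseDeriv F j

/-- A formal power series in `u`, viewed as a Laurent series. -/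
def toLaurent (g : F⟦X⟧) : F⸨X⸩ := HahnSeries.ofPowerSeries ℤ F g

end Formal

end CarlitzTheta

end

namespace CarlitzTheta

open Filter Topology
open scoped Polynomial PowerSeries LaurentSeries
open Finset.HasAntidiagonal (antidiagonal)

/-! ## Nonarchimedean analysis -/

section Ultrametric

variable {K : Type*} [NormedField K] [IsUltrametricDist K]

/-! Write `e_A(z) = expA ρ z` for the exponential of the lattice `A`, so that `e_C(π̃ z) = π̃
e_A(z)` and `u = 1 / (π̃ e_A)`. Two facts about `e_A` carry the theorem: it is additive, and it is
the limit of the polynomials `E_d(z) = z ∏ (1 - z / a)` over nonzero `a` of degree less than `d`.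

Goss polynomials. In characteristic `p` the additive polynomial `E_d` has derivative `1`, so
logarithmic differentiation gives `∑ 1 / (w - a) = 1 / E_d(w)` over `deg a < d`. With `w = z - X`, a
point over the ring of power series, the right side is `1 / (E_d(z) - E_d(X))`. Comparing
coefficients of `X ^ r` and letting `d → ∞` yields `β_{r,j} = π̃ ^ (j - r) [X ^ r] e_A(X) ^ j`
(`sum_inv_pow_sub_ofA`, `isGossPoly_carlitzGoss`, `gossPoly_carlitzLattice`). That the limit of the
`E_d` really involves the product defining `π̃` rests on the coefficient recursion
`linCoeff_succ_eq`, whose factor tends to `π̃ ^ (q - 1)` (`tendsto_recFactor`).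

Expansion of `Θ^r(f)`. Additivity gives `u(z + x) = u / (1 + u π̃ e_A(x))` with `u = u(z)`
(`uParam_add`). Substituting into `f = ∑ c_n u ^ n` and using the binomial series, `f(z + x) = ∑ c_n
(-1) ^ j binom(n + j - 1, j) u ^ (n + j) π̃ ^ j e_A(x) ^ j`. The coefficient of `x ^ r` involves the
same numbers `[X ^ r] e_A(X) ^ j`. Since `e_A` is odd, the signs agree with those of `(-π̃) ^ (-r)`,
and `Θ^r(f) = ∑ β_{r,j} c_n binom(n + j - 1, j) u ^ (n + j)` (`HasUExpansion.hasTaylor`,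
`HasUExpansion.thetaOp`).

Both formulas are readings of this sum: `binom(n + j - 1, j)` comes from `∂_u^j(u ^ (n + j - 1))`,
while the equal number `binom(n + j - 1, n - 1)`, for `n ≥ 1`, comes from `∂_u^{n-1}(u ^ (n + j -
1))`. The terms with `n = 0` make up `Θ^r(c_0)`.

Membership in `𝒰(Ω)` also needs hyperderivatives to preserve rigid analyticity
(`IsHolomorphic.exists_taylor`). This follows from the Cauchy estimate `norm_coeff_mul_pow_le`,
because hyperderivatives of rational functions are rational. -/

lemma norm_le_of_hasSum {ι : Type*} {f : ι → K} {a : K} {M : ℝ} (h : HasSum f a) (hM : 0 ≤ M)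
    (hf : ∀ i, ‖f i‖ ≤ M) : ‖a‖ ≤ M := by
  have : a ∈ Metric.closedBall (0 : K) M := by
    refine Metric.isClosed_closedBall.mem_of_tendsto h (Eventually.of_forall fun s => ?_)
    simpa using IsUltrametricDist.norm_sum_le_of_forall_le_of_nonneg hM fun i _ => hf i
  simpa using this

lemma nonarchimedeanRing_of_isUltrametricDist : NonarchimedeanRing K where
  is_nonarchimedean := NonarchimedeanAddGroup.is_nonarchimedean

lemma norm_sub_le_max' (x y : K) : ‖x - y‖ ≤ max ‖x‖ ‖y‖ := by
  simpa [sub_eq_add_neg] using IsUltrametricDist.norm_add_le_max x (-y)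

lemma norm_eq_of_norm_sub_lt {x y : K} (h : ‖x - y‖ < ‖y‖) : ‖x‖ = ‖y‖ := by
  have h1 := IsUltrametricDist.norm_add_le_max (x - y) y
  have h2 := norm_sub_le_max' x (x - y)
  simp only [sub_add_cancel, sub_sub_cancel] at h1 h2
  apply le_antisymm
  · rwa [max_eq_right h.le] at h1
  · rcases le_max_iff.1 h2 with h3 | h3
    · exact h3
    · linarith

lemma norm_prod_one_add_sub_one_le {ι : Type*} (s : Finset ι) (f : ι → K) {ε : ℝ} (hε : ε ≤ 1)
    (h0 : 0 ≤ ε) (hf : ∀ i ∈ s, ‖f i‖ ≤ ε) : ‖∏ i ∈ s, (1 + f i) - 1‖ ≤ ε := by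
  classical
  induction s using Finset.induction_on with
  | empty => simpa using h0
  | insert i s hi ih =>
    rw [Finset.prod_insert hi]
    have h1 := ih fun j hj => hf j (Finset.mem_insert_of_mem hj)
    have h2 := hf i (Finset.mem_insert_self i s)
    have h3 : ‖1 + f i‖ ≤ 1 := (IsUltrametricDist.norm_add_le_max _ _).trans (by simp; linarith)
    have : (1 + f i) * ∏ j ∈ s, (1 + f j) - 1 = (1 + f i) * (∏ j ∈ s, (1 + f j) - 1) + f i := by
      ring
    rw [this]
    refine (IsUltrametricDist.norm_add_le_max _ _).trans (max_le ?_ h2)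
    rw [norm_mul]
    nlinarith [norm_nonneg (∏ j ∈ s, (1 + f j) - 1)]

/-- Outside a finite set `s₀` all factors have norm at most `1`, so partial products stay bounded by
`B`. Outside a larger finite set the remaining factors multiply to something within `δ` of `1`,
which makes the net of partial products Cauchy. -/
lemma multipliable_one_add_of_tendsto_cofinite [CompleteSpace K] {ι : Type*} {f : ι → K}
    (hf : Tendsto f cofinite (𝓝 0)) : Multipliable fun i => 1 + f i := by
  classical
  have hf' : Tendsto (fun i => ‖f i‖) cofinite (𝓝 0) := by simpa using hf.norm
  have key : ∀ ε : ℝ, 0 < ε → ∃ s : Finset ι, ∀ i ∉ s, ‖f i‖ < ε := fun ε hε => by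
    have := hf'.eventually (gt_mem_nhds hε)
    rw [eventually_cofinite] at this
    exact ⟨this.toFinset, fun i hi => by simpa using hi⟩
  suffices CauchySeq fun s : Finset ι => ∏ i ∈ s, (1 + f i) by
    obtain ⟨a, ha⟩ := cauchySeq_tendsto_of_complete this
    exact ⟨a, ha⟩
  rw [Metric.cauchySeq_iff']
  intro ε hε
  obtain ⟨s₀, hs₀⟩ := key 1 one_pos
  set B := ‖∏ i ∈ s₀, (1 + f i)‖ with hB
  have hB0 : 0 ≤ B := norm_nonneg _
  set δ := min 1 (ε / (2 * (B + 1)))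
  have hδ0 : 0 < δ := lt_min one_pos (by positivity)
  obtain ⟨s₁, hs₁⟩ := key δ hδ0
  have step : ∀ s t : Finset ι, s ⊆ t → ∏ i ∈ t, (1 + f i) =
      (∏ i ∈ s, (1 + f i)) * ∏ i ∈ t \ s, (1 + f i) := fun s t h => by
    rw [mul_comm, Finset.prod_sdiff h]
  have hBs : ‖∏ i ∈ s₀ ∪ s₁, (1 + f i)‖ ≤ B := by
    rw [step s₀ _ Finset.subset_union_left, norm_mul]
    refine mul_le_of_le_one_right (norm_nonneg _) ?_
    have := norm_prod_one_add_sub_one_le ((s₀ ∪ s₁) \ s₀) f le_rfl zero_le_one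
      fun i hi => (hs₀ i (Finset.mem_sdiff.1 hi).2).le
    have h2 := IsUltrametricDist.norm_add_le_max (∏ i ∈ (s₀ ∪ s₁) \ s₀, (1 + f i) - 1) 1
    simpa [this] using h2
  refine ⟨s₀ ∪ s₁, fun t ht => ?_⟩
  have ht' : s₀ ∪ s₁ ⊆ t := ht
  rw [dist_eq_norm, step _ _ ht', ← mul_sub_one, norm_mul]
  have h1 := norm_prod_one_add_sub_one_le (t \ (s₀ ∪ s₁)) f (min_le_left _ _ : δ ≤ 1) hδ0.le
      fun i hi => (hs₁ i (fun h => (Finset.mem_sdiff.1 hi).2 (Finset.mem_union_right _ h))).le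
  have h2 : δ ≤ ε / (2 * (B + 1)) := min_le_right _ _
  calc _ ≤ B * (ε / (2 * (B + 1))) := mul_le_mul hBs (h1.trans h2) (norm_nonneg _) hB0
    _ < ε := by
      rw [mul_div_assoc', div_lt_iff₀ (by positivity)]
      nlinarith

/-- A convergent power series vanishing at a sequence of nonzero points tending to `0` is zero. -/
lemma powerSeries_coeff_eq_zero {a : ℕ → K}
    (h : ∀ ε : ℝ, 0 < ε → ∃ x : K, x ≠ 0 ∧ ‖x‖ < ε ∧ HasSum (fun n => a n * x ^ n) 0) (n : ℕ) :
    a n = 0 := by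
  by_contra hn
  classical
  have hex : ∃ n, a n ≠ 0 := ⟨n, hn⟩
  set m := Nat.find hex
  have hm : a m ≠ 0 := Nat.find_spec hex
  have hlt : ∀ k < m, a k = 0 := fun k hk => by simpa using Nat.find_min hex hk
  obtain ⟨x₀, hx₀, -, hs₀⟩ := h 1 one_pos
  obtain ⟨B, hB⟩ : ∃ B : ℝ, ∀ n, ‖a n * x₀ ^ n‖ ≤ B := by
    have := hs₀.summable.tendsto_atTop_zero.norm.bddAbove_range
    obtain ⟨B, hB⟩ := this
    exact ⟨B, fun n => hB ⟨n, rfl⟩⟩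
  have hB0 : 0 ≤ B := (norm_nonneg _).trans (hB 0)
  have hx₀' : 0 < ‖x₀‖ := norm_pos_iff.2 hx₀
  have ham : 0 < ‖a m‖ * ‖x₀‖ ^ m := by positivity
  -- The point `x` is so small compared with `x₀` that the terms beyond the first nonzero one,
  -- bounded by `t ^ (m + 1) * B` with `t = ‖x‖ / ‖x₀‖`, cannot cancel `a m * x ^ m`.
  obtain ⟨x, hx, hxε, hs⟩ := h (‖x₀‖ * min 1 (‖a m‖ * ‖x₀‖ ^ m / (B + 1))) (by positivity)
  have hx' : 0 < ‖x‖ := norm_pos_iff.2 hx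
  set t := ‖x‖ / ‖x₀‖ with ht
  have ht0 : 0 < t := by positivity
  have hxt : ‖x‖ = t * ‖x₀‖ := by rw [ht]; field_simp
  have htm : t < min 1 (‖a m‖ * ‖x₀‖ ^ m / (B + 1)) := by
    rw [ht, div_lt_iff₀ hx₀', mul_comm]; exact hxε
  have ht1 : t < 1 := htm.trans_le (min_le_left _ _)
  have ht2 : t * (B + 1) < ‖a m‖ * ‖x₀‖ ^ m := by
    rw [← lt_div_iff₀ (by positivity)]; exact htm.trans_le (min_le_right _ _)
  have h1 : HasSum (fun n => if n = m then 0 else a n * x ^ n) (0 - a m * x ^ m) := by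
    have := hs.sub (hasSum_ite_eq m (a m * x ^ m))
    refine this.congr_fun ?_ |> fun h => h
    intro i
    by_cases hi : i = m <;> simp [hi]
  have h2 : ‖0 - a m * x ^ m‖ ≤ t ^ (m + 1) * B := by
    refine norm_le_of_hasSum h1 (by positivity) fun i => ?_
    by_cases hi : i = m
    · simp only [hi, if_true, norm_zero]; positivity
    rw [if_neg hi]
    rcases lt_or_ge i m with hlm | hge
    · rw [hlt i hlm]; simp only [zero_mul, norm_zero]; positivity
    · have h3 := hB i
      rw [norm_mul, norm_pow] at h3 ⊢
      rw [hxt, mul_pow]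
      calc _ = t ^ i * (‖a i‖ * ‖x₀‖ ^ i) := by ring
        _ ≤ t ^ (m + 1) * B := by
          refine mul_le_mul (pow_le_pow_of_le_one ht0.le ht1.le (by omega)) h3 (by positivity)
            (by positivity)
  rw [zero_sub, norm_neg, norm_mul, norm_pow, hxt, mul_pow, pow_succ] at h2
  have h3 : 0 < t ^ m := by positivity
  have : t ^ m * (‖a m‖ * ‖x₀‖ ^ m) ≤ t ^ m * (t * B) := by linarith
  have := le_of_mul_le_mul_left this h3
  nlinarith

end Ultrametric

/-! ### The Cauchy estimate by averaging over roots of unity -/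

section Cauchy

variable {K : Type*} [NormedField K] [IsUltrametricDist K]

lemma sum_pow_eq_zero_of_pow_eq_one {K : Type*} [Field K] {m : ℕ} {w : K} (h1 : w ^ m = 1) (h : w ≠ 1) :
    ∑ k ∈ Finset.range m, w ^ k = 0 := by
  rw [geom_sum_eq h, h1, sub_self, zero_div]

/-- The nonarchimedean Cauchy estimate. -/
lemma norm_coeff_mul_pow_le [IsAlgClosed K] (p : ℕ) [Fact p.Prime] [CharP K p]
    {a : ℕ → K} {g : K → K} {x : K} {M : ℝ} (hM : 0 ≤ M)
    (h : ∀ y : K, ‖y‖ = ‖x‖ → HasSum (fun n => a n * y ^ n) (g y))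
    (hg : ∀ y : K, ‖y‖ = ‖x‖ → ‖g y‖ ≤ M) (j : ℕ) : ‖a j * x ^ j‖ ≤ M := by
  refine le_of_forall_pos_le_add fun ε hε => ?_
  have htend := (h x rfl).summable.tendsto_atTop_zero.norm
  rw [norm_zero] at htend
  obtain ⟨N, hN⟩ := eventually_atTop.1 (htend.eventually (gt_mem_nhds hε))
  have hp := Fact.out (p := p.Prime)
  -- Averaging over the `m`-th roots of unity isolates the indices congruent to `j` modulo `m`.
  -- Taking `m ≡ 1` modulo `p` makes `m = 1` in `K`, so no division is needed and primitive roots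
  -- exist. Taking `m` larger than `N` and `j` ensures that every index other than `j` that survives
  -- has a term below `ε`.
  set m := (N + j + 1) * p + 1 with hm
  have hmK : (m : K) = 1 := by simp [hm]
  have hjm : j < m := by have := hp.one_lt; nlinarith
  have hNm : N ≤ m := by have := hp.one_lt; nlinarith
  have : NeZero (m : K) := ⟨by rw [hmK]; exact one_ne_zero⟩
  obtain ⟨ζ, hζ⟩ := HasEnoughRootsOfUnity.exists_primitiveRoot K m
  have hζ0 : ζ ≠ 0 := hζ.ne_zero (by omega)
  have hζn : ‖ζ‖ = 1 := by
    have : ‖ζ‖ ^ m = 1 := by rw [← norm_pow, hζ.pow_eq_one, norm_one]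
    exact (pow_eq_one_iff_of_nonneg (norm_nonneg _) (by omega)).1 this
  have hS : HasSum (fun n => ∑ k ∈ Finset.range m, (ζ⁻¹ ^ j) ^ k * (a n * (ζ ^ k * x) ^ n))
      (∑ k ∈ Finset.range m, (ζ⁻¹ ^ j) ^ k * g (ζ ^ k * x)) :=
    hasSum_sum fun k _ => (h _ (by simp [hζn])).mul_left _
  have hSn : ‖∑ k ∈ Finset.range m, (ζ⁻¹ ^ j) ^ k * g (ζ ^ k * x)‖ ≤ M :=
    IsUltrametricDist.norm_sum_le_of_forall_le_of_nonneg hM fun k _ => by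
      simpa [hζn] using hg (ζ ^ k * x) (by simp [hζn])
  have hterm : ∀ n, ∑ k ∈ Finset.range m, (ζ⁻¹ ^ j) ^ k * (a n * (ζ ^ k * x) ^ n) =
      a n * x ^ n * ∑ k ∈ Finset.range m, (ζ⁻¹ ^ j * ζ ^ n) ^ k := fun n => by
    rw [Finset.mul_sum]
    refine Finset.sum_congr rfl fun k _ => ?_
    rw [mul_pow, mul_pow, pow_right_comm ζ k n]; ring
  simp_rw [hterm] at hS
  have hS2 := hS.sub (hasSum_ite_eq j (a j * x ^ j))
  have h3 : ‖∑ k ∈ Finset.range m, (ζ⁻¹ ^ j) ^ k * g (ζ ^ k * x) - a j * x ^ j‖ ≤ ε := by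
    refine norm_le_of_hasSum hS2 hε.le fun i => ?_
    by_cases hij : i = j
    · subst hij
      simp [hζ0, hmK, hε.le]
    rw [if_neg hij, sub_zero]
    rcases lt_or_ge i m with hi | hi
    · rw [sum_pow_eq_zero_of_pow_eq_one]
      · simpa using hε.le
      · rw [mul_pow, ← pow_mul, ← pow_mul, mul_comm j, mul_comm i, pow_mul, pow_mul, inv_pow,
          hζ.pow_eq_one]; simp
      · intro h1
        rw [inv_pow, inv_mul_eq_one₀ (pow_ne_zero _ hζ0)] at h1
        exact hij (hζ.pow_inj hjm hi h1).symm
    · rw [norm_mul]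
      refine (mul_le_of_le_one_right (norm_nonneg _) ?_).trans (hN i (hNm.trans hi)).le
      exact IsUltrametricDist.norm_sum_le_of_forall_le_of_nonneg zero_le_one fun k _ => by
        simp [hζn]
  have h4 := norm_sub_le_max' (∑ k ∈ Finset.range m, (ζ⁻¹ ^ j) ^ k * g (ζ ^ k * x))
    (∑ k ∈ Finset.range m, (ζ⁻¹ ^ j) ^ k * g (ζ ^ k * x) - a j * x ^ j)
  rw [sub_sub_cancel] at h4
  refine h4.trans (max_le ?_ ?_) <;> linarith

end Cauchy

/-! ## Power series expansions of rational functions -/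

section DiscSeries

variable {K : Type*} [NormedField K]

/-- `g(z + x) = ∑ a_j x ^ j` for all `x` with `‖x‖ < δ`. -/
def HasDiscSeries (g : K → K) (z : K) (δ : ℝ) (a : ℕ → K) : Prop :=
  ∀ x : K, ‖x‖ < δ → HasSum (fun j => a j * x ^ j) (g (z + x))

lemma hasDiscSeries_polynomial (P : K[X]) (z : K) (δ : ℝ) :
    HasDiscSeries (fun w => P.eval w) z δ fun j => (Polynomial.hasseDeriv j P).eval z := by
  intro x _
  have h : P.eval (z + x) = (Polynomial.taylor z P).eval x := by
    rw [Polynomial.taylor_eval, add_comm]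
  simp_rw [← Polynomial.taylor_coeff]
  rw [h, Polynomial.eval_eq_sum_range]
  refine hasSum_sum_of_ne_finset_zero fun j hj => ?_
  rw [Polynomial.coeff_eq_zero_of_natDegree_lt (by simpa using hj), zero_mul]

lemma HasDiscSeries.const_mul {g : K → K} {z : K} {δ : ℝ} {a : ℕ → K}
    (h : HasDiscSeries g z δ a) (c : K) :
    HasDiscSeries (fun w => c * g w) z δ fun j => c * a j := fun x hx => by
  simpa [mul_assoc] using (h x hx).mul_left c

lemma HasDiscSeries.congr {g g' : K → K} {z : K} {δ : ℝ} {a : ℕ → K}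
    (h : HasDiscSeries g z δ a) (hg : ∀ x, ‖x‖ < δ → g (z + x) = g' (z + x)) :
    HasDiscSeries g' z δ a := fun x hx => hg x hx ▸ h x hx

lemma hasDiscSeries_inv_sub {α z : K} {δ : ℝ} (h : δ ≤ ‖z - α‖) :
    HasDiscSeries (fun w => (w - α)⁻¹) z δ fun j => (z - α)⁻¹ * (-(z - α)⁻¹) ^ j := by
  intro x hx
  have h0 : 0 < ‖z - α‖ := (norm_nonneg x).trans_lt (hx.trans_le h)
  have h0' : z - α ≠ 0 := norm_pos_iff.1 h0
  have hr : ‖-(z - α)⁻¹ * x‖ < 1 := by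
    rw [norm_mul, norm_neg, norm_inv, inv_mul_lt_iff₀ h0, mul_one]
    exact hx.trans_le h
  have := (hasSum_geometric_of_norm_lt_one hr).mul_left (z - α)⁻¹
  have h2 : (z - α)⁻¹ * (1 - -(z - α)⁻¹ * x)⁻¹ = (z + x - α)⁻¹ := by
    rw [← mul_inv]; congr 1; field_simp; ring
  rw [h2] at this
  simpa only [mul_pow, mul_assoc] using this

variable [IsUltrametricDist K]

lemma HasDiscSeries.mul {g g' : K → K} {z : K} {δ : ℝ} {a a' : ℕ → K}
    (h : HasDiscSeries g z δ a) (h' : HasDiscSeries g' z δ a') :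
    HasDiscSeries (fun w => g w * g' w) z δ
      fun n => ∑ ij ∈ antidiagonal n, a ij.1 * a' ij.2 := fun x hx => by
  have : NonarchimedeanRing K := nonarchimedeanRing_of_isUltrametricDist
  have h1 := (h x hx).mul_of_nonarchimedean (h' x hx)
  have h2 := (Finset.HasAntidiagonal.sigmaAntidiagonalEquivProd (A := ℕ)).hasSum_iff.2 h1
  have h3 := h2.sigma (g := fun n => (∑ ij ∈ antidiagonal n, a ij.1 * a' ij.2) * x ^ n)
    fun n => by
      have := hasSum_fintype (fun c : antidiagonal n =>
        a c.1.1 * x ^ c.1.1 * (a' c.1.2 * x ^ c.1.2))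
      convert! this using 1
      rw [Finset.sum_mul, ← Finset.sum_attach]
      refine Finset.sum_congr rfl fun c _ => ?_
      have hc := Finset.HasAntidiagonal.mem_antidiagonal.1 c.2
      have hx : x ^ n = x ^ c.1.1 * x ^ c.1.2 := by rw [← pow_add, hc]
      rw [hx]; ring
  exact h3

lemma HasDiscSeries.unique {K : Type*} [NontriviallyNormedField K] [IsUltrametricDist K]
    {g : K → K} {z : K} {δ : ℝ} {a a' : ℕ → K} (hδ : 0 < δ)
    (h : HasDiscSeries g z δ a) (h' : HasDiscSeries g z δ a') : a = a' := by
  funext n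
  rw [← sub_eq_zero]
  refine powerSeries_coeff_eq_zero (a := fun n => a n - a' n) (fun ε hε => ?_) n
  obtain ⟨x, hx0, hx⟩ := NormedField.exists_norm_lt K (lt_min hε hδ)
  refine ⟨x, norm_pos_iff.1 hx0, hx.trans_le (min_le_left _ _), ?_⟩
  have := (h x (hx.trans_le (min_le_right _ _))).sub (h' x (hx.trans_le (min_le_right _ _)))
  simpa [sub_mul] using this

lemma exists_hasDiscSeries_inv_prod (s : Multiset K) {z : K} {δ : ℝ}
    (h : ∀ α ∈ s, δ ≤ ‖z - α‖) :
    ∃ a, HasDiscSeries (fun w => ((s.map fun α => w - α).prod)⁻¹) z δ a := by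
  induction s using Multiset.induction_on with
  | empty =>
    refine ⟨_, (hasDiscSeries_polynomial (1 : K[X]) z δ).congr ?_⟩
    simp
  | cons α s ih =>
    obtain ⟨a, ha⟩ := ih fun β hβ => h β (Multiset.mem_cons_of_mem hβ)
    refine ⟨_, ((hasDiscSeries_inv_sub (h α (Multiset.mem_cons_self α s))).mul ha).congr ?_⟩
    intro x _
    simp [mul_comm]

/-- A rational function without poles on an open disc is given there by a power series. -/
lemma exists_hasDiscSeries_div [IsAlgClosed K] (P Q : K[X]) {z : K} {δ : ℝ} (hδ : 0 < δ)
    (h : ∀ x, ‖x‖ < δ → Q.eval (z + x) ≠ 0) :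
    ∃ a, HasDiscSeries (fun w => P.eval w / Q.eval w) z δ a := by
  have hQ : Q ≠ 0 := fun h0 => h 0 (by simpa using hδ) (by simp [h0])
  have hev : ∀ w, Q.eval w = Q.leadingCoeff * (Q.roots.map fun α => w - α).prod := fun w => by
    conv_lhs => rw [(IsAlgClosed.splits Q).eq_prod_roots]
    simp [Polynomial.eval_multiset_prod, Multiset.map_map]
  -- A root of `Q` at distance less than `δ` from `z` would be a pole in the disc.
  obtain ⟨a, ha⟩ := exists_hasDiscSeries_inv_prod Q.roots (z := z) (δ := δ) fun α hα => by
    by_contra! hlt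
    refine h (α - z) (by rwa [norm_sub_rev]) ?_
    rw [add_sub_cancel]
    exact (Polynomial.mem_roots hQ).1 hα
  refine ⟨_, ((hasDiscSeries_polynomial P z δ).mul (ha.const_mul Q.leadingCoeff⁻¹)).congr ?_⟩
  intro x _
  simp only [hev, div_eq_mul_inv, mul_inv]

end DiscSeries

/-! ### Hyperderivatives of rational functions -/

section RationalHyperderivative

variable {K : Type*} [Field K]

/-- Hyperderivatives of a rational function are rational functions with the same poles. -/
lemma exists_rational_hyperderivative (P Q : K[X]) (r : ℕ) :
    ∃ N : K[X], ∀ (z : K) (a : ℕ → K), Q.eval z ≠ 0 →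
      (∀ n, ∑ ij ∈ antidiagonal n, (Polynomial.hasseDeriv ij.1 Q).eval z * a ij.2 =
        (Polynomial.hasseDeriv n P).eval z) →
      a r = N.eval z / (Q ^ (r + 1)).eval z := by
  induction r using Nat.strong_induction_on with
  | _ r ih =>
    choose N hN using ih
    -- The Leibniz relation for `Q * g = P` is solved for the coefficient `a r`, and denominators
    -- are cleared by `Q ^ r`. The exponent `r - 1 - i` is a true difference, since `i < r`.
    refine ⟨Q ^ r * Polynomial.hasseDeriv r P - ∑ i : Fin r,
      Polynomial.hasseDeriv (r - i) Q * N i i.2 * Q ^ (r - 1 - i), fun z a hQ h => ?_⟩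
    have h1 := h r
    rw [Finset.Nat.sum_antidiagonal_eq_sum_range_succ_mk, ← Finset.sum_range_reflect] at h1
    have h2 : ∀ j ∈ Finset.range r.succ, r + 1 - 1 - j = r - j ∧ r - (r + 1 - 1 - j) = j :=
      fun j hj => by have := Finset.mem_range.1 hj; omega
    rw [Finset.sum_congr rfl fun j hj => by rw [(h2 j hj).2, (h2 j hj).1],
      Finset.sum_range_succ, Nat.sub_self, Polynomial.hasseDeriv_zero', ← Fin.sum_univ_eq_sum_range
        (fun j => (Polynomial.hasseDeriv (r - j) Q).eval z * a j)] at h1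
    have h3 : Q.eval z * a r = _ := eq_sub_iff_add_eq'.2 h1
    rw [Polynomial.eval_pow, eq_div_iff (pow_ne_zero _ hQ), pow_succ', ← mul_assoc, mul_comm (a r),
      h3, sub_mul, Polynomial.eval_sub, Polynomial.eval_mul,
      Polynomial.eval_finsetSum, Finset.sum_mul, Polynomial.eval_pow, mul_comm]
    congr 1
    refine Finset.sum_congr rfl fun i _ => ?_
    rw [hN i i.2 z a hQ h]
    simp only [Polynomial.eval_mul, Polynomial.eval_pow]
    have : Q.eval z ^ r = Q.eval z ^ (i.1 + 1) * Q.eval z ^ (r - 1 - i) := by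
      rw [← pow_add]; congr 1; omega
    rw [this]
    field_simp

end RationalHyperderivative

/-! ### Uniform limits of power series -/

section UniformLimit

/-- If, on a disc, power series converge uniformly to `g` and have uniformly Cauchy coefficients,
then `g` is given on smaller discs by the power series of the limits of the coefficients. -/
lemma hasSum_of_uniform_limit {K : Type*} [NormedField K] [IsUltrametricDist K]
    [CompleteSpace K] {b : ℕ → ℕ → K} {B : ℕ → K} {s : ℕ → K} {S : K} {ε : ℕ → ℝ}
    (hε : Tendsto ε atTop (𝓝 0)) (hb : ∀ k j, ‖b k j - B j‖ ≤ ε k)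
    (hs : ∀ k, HasSum (b k) (s k)) (hS : ∀ k, ‖s k - S‖ ≤ ε k) : HasSum B S := by
  have hB : Tendsto B cofinite (𝓝 0) := by
    rw [Metric.tendsto_nhds]
    intro e he
    obtain ⟨k, hk⟩ := (hε.eventually (gt_mem_nhds (half_pos he))).exists
    have := (hs k).summable.tendsto_cofinite_zero
    rw [Metric.tendsto_nhds] at this
    filter_upwards [this (e / 2) (half_pos he)] with j hj
    rw [dist_zero_right] at hj ⊢
    have h1 : ‖B j‖ ≤ ‖b k j‖ + ‖b k j - B j‖ := by
      simpa using norm_sub_le (b k j) (b k j - B j)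
    linarith [hb k j]
  obtain ⟨T, hT⟩ := NonarchimedeanAddGroup.summable_of_tendsto_cofinite_zero hB
  have : S = T := by
    rw [← sub_eq_zero, ← norm_eq_zero]
    refine le_antisymm (ge_of_tendsto (by simpa using hε.add hε) (Eventually.of_forall fun k => ?_))
      (norm_nonneg _)
    have h0 : 0 ≤ ε k := (norm_nonneg _).trans (hS k)
    have h1 := norm_le_of_hasSum ((hs k).sub hT) h0 (hb k)
    calc ‖S - T‖ = ‖(s k - T) - (s k - S)‖ := by congr 1; ring
      _ ≤ _ := norm_sub_le _ _
      _ ≤ _ := add_le_add h1 (hS k)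
  rwa [this]

end UniformLimit

/-! ## The field `ℂ_∞` -/

/-- An ultrametric complete field with a dense algebraically closed subfield is algebraically
closed. -/
theorem isAlgClosed_of_denseRange_of_ultrametric {K L : Type*} [Field K]
    [NontriviallyNormedField L] [CompleteSpace L] [IsUltrametricDist L] [Algebra K L]
    (hi : DenseRange (algebraMap K L)) [IsAlgClosed K] : IsAlgClosed L := by
  apply IsAlgClosed.of_exists_root
  intro f fmon firr
  have fnatdeg0 : f.natDegree ≠ 0 := (Irreducible.natDegree_pos firr).ne'
  let F := f.SplittingField
  let : NormedField F := spectralNorm.normedField L F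
  let : NormedAlgebra L F := spectralNorm.normedAlgebra L F
  let a := Polynomial.rootOfSplits (Polynomial.SplittingField.splits f)
      (by simpa using Polynomial.degree_ne_of_natDegree_ne fnatdeg0)
  have fa0 : f.aeval a = 0 := by
    rw [← Polynomial.eval_map_algebraMap]
    exact Polynomial.eval_rootOfSplits (Polynomial.SplittingField.splits f)
      (by simpa using Polynomial.degree_ne_of_natDegree_ne fnatdeg0)
  have hclosed : IsClosed (Set.range (algebraMap L F)) :=
    ((algebraMap_isometry L F).isUniformInducing.isComplete_range).isClosed
  -- A monic `g` over `K` close to `f` has a root close to `a`. As `g` splits over `K`, that root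
  -- comes from `L`. Since `L` is complete, it is closed in `F`, and so contains `a`.
  have hmem : a ∈ closure (Set.range (algebraMap L F)) := by
    rw [Metric.mem_closure_iff]
    intro δ δpos
    -- Chosen so that the bound for the continuity of roots becomes exactly `δ`.
    have hε : (δ / (max ‖a‖ 1)) ^ f.natDegree / (f.natDegree + 1) > 0 := by positivity
    obtain ⟨g, gmon, gdeg, gcoeff⟩ :=
      Polynomial.exists_monic_and_natDegree_eq_and_norm_map_algebraMap_coeff_sub_lt hi fmon hε
    obtain ⟨b, hb, hab⟩ := Polynomial.exists_aroots_norm_sub_lt_of_norm_coeff_sub_lt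
        hε fa0 fmon (gmon.map _) (gdeg ▸ (g.natDegree_map _)) gcoeff
        (by simpa [Polynomial.map_map] using (IsAlgClosed.splits g).map ((algebraMap L F).comp _))
    rw [← Real.rpow_natCast, ← mul_comm_div, div_self, one_mul,
        ← Real.rpow_mul (div_pos δpos (by positivity)).le, mul_inv_cancel₀] at hab
    · refine ⟨b, ?_, ?_⟩
      · rw [Polynomial.aroots_def, Polynomial.Splits.roots_map ((IsAlgClosed.splits g).map _),
          Multiset.mem_map] at hb
        obtain ⟨c, _, hc⟩ := hb
        exact ⟨c, hc⟩
      · rw [dist_eq_norm]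
        simpa [mul_assoc, div_mul_cancel₀ _ (by positivity : (max ‖a‖ 1) > 0).ne'] using hab
    · simp [fnatdeg0]
    · positivity
  rw [hclosed.closure_eq] at hmem
  obtain ⟨c, hc⟩ := hmem
  refine ⟨c, (algebraMap L F).injective ?_⟩
  rwa [← Polynomial.aeval_algebraMap_apply_eq_algebraMap_eval, hc, map_zero]

section CInf

variable {Fq : Type*} [Field Fq] [Fintype Fq]

instance KInfAlg.isUltrametricDist : IsUltrametricDist (KInfAlg Fq) :=
  IsUltrametricDist.isUltrametricDist_of_forall_norm_add_le_max_norm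
    (isNonarchimedean_spectralNorm (K := KInf Fq) (L := KInfAlg Fq))

instance CInf.isUltrametricDist : IsUltrametricDist (CInf Fq) := by
  refine IsUltrametricDist.isUltrametricDist_of_forall_norm_add_le_max_norm fun x y => ?_
  induction x, y using UniformSpace.Completion.induction_on₂ with
  | hp => exact isClosed_le (by fun_prop) (by fun_prop)
  | ih a b =>
    rw [← UniformSpace.Completion.coe_add]
    simp only [UniformSpace.Completion.norm_coe]
    exact IsUltrametricDist.norm_add_le_max a b

variable (Fq) in
lemma one_lt_qCard : 1 < (qCard Fq : ℝ) := by exact_mod_cast Fintype.one_lt_card (α := Fq)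

noncomputable instance CInf.nontriviallyNormedField : NontriviallyNormedField (CInf Fq) where
  toNormedField := inferInstance
  non_trivial := ⟨theta Fq, by rw [norm_theta]; exact one_lt_qCard Fq⟩

instance CInf.isAlgClosed : IsAlgClosed (CInf Fq) :=
  letI : Algebra (KInfAlg Fq) (CInf Fq) :=
    (UniformSpace.Completion.coeRingHom : KInfAlg Fq →+* CInf Fq).toAlgebra
  isAlgClosed_of_denseRange_of_ultrametric (K := KInfAlg Fq)
    UniformSpace.Completion.denseRange_coe

instance CInf.charP : CharP (CInf Fq) (ringChar Fq) :=
  charP_of_injective_ringHom (f := (ofA Fq).comp Polynomial.C) (RingHom.injective _) _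

instance fact_prime_ringChar : Fact (ringChar Fq).Prime :=
  ⟨CharP.char_is_prime Fq (ringChar Fq)⟩

lemma norm_ofKInf (x : KInf Fq) : ‖ofKInf Fq x‖ = ‖x‖ :=
  (UniformSpace.Completion.norm_coe _).trans (spectralNorm_extends x)

lemma isometry_ofKInf : Isometry (ofKInf Fq) :=
  AddMonoidHomClass.isometry_of_norm _ norm_ofKInf

lemma norm_KInf_eq (x : KInf Fq) : ‖x‖ = ((WithZeroMulInt.toNNReal (qCard_nnreal_ne_zero Fq)
      (Valued.v x) : NNReal) : ℝ) := by
  change ((WithZeroMulInt.toNNReal (qCard_nnreal_ne_zero Fq)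
    (MonoidWithZeroHom.ValueGroup₀.embedding (Valued.v.restrict x)) : NNReal) : ℝ) = _
  rw [Valuation.embedding_restrict]

lemma exists_norm_KInf_eq_zpow {x : KInf Fq} (hx : x ≠ 0) :
    ∃ m : ℤ, ‖x‖ = (qCard Fq : ℝ) ^ m := by
  rw [norm_KInf_eq, WithZeroMulInt.toNNReal_neg_apply _ ((Valuation.ne_zero_iff _).2 hx)]
  exact ⟨_, by push_cast; rfl⟩

open Classical in
lemma norm_ofA {a : Fq[X]} (ha : a ≠ 0) : ‖ofA Fq a‖ = (qCard Fq : ℝ) ^ a.natDegree := by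
  have h : (Valued.v (polyToKInf Fq a) : WithZero (Multiplicative ℤ)) =
      WithZero.exp (a.natDegree : ℤ) := by
    have h := @Valued.extensionValuation_apply_coe (RatFunc Fq) _ _ _ (RatFunc.inftyValued Fq)
      (algebraMap Fq[X] (RatFunc Fq) a)
    refine h.trans ?_
    exact RatFunc.inftyValuation.polynomial Fq ha
  change ‖ofKInf Fq (polyToKInf Fq a)‖ = _
  rw [norm_ofKInf, norm_KInf_eq, h, WithZeroMulInt.toNNReal_neg_apply _ WithZero.exp_ne_zero]
  change (((qCard Fq : NNReal) ^ (a.natDegree : ℤ) : NNReal) : ℝ) = _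
  simp

lemma ofA_injective : Function.Injective (ofA Fq) := by
  rw [injective_iff_map_eq_zero]
  intro a ha
  by_contra h
  have h1 := norm_ofA h
  rw [ha, norm_zero] at h1
  exact (pow_pos (zero_lt_one.trans (one_lt_qCard Fq)) _).ne h1

/-- The polynomials of degree less than `d`. -/
noncomputable def polyLT (Fq : Type*) [Field Fq] [Fintype Fq] (d : ℕ) : Finset Fq[X] :=
  have : Finite (Polynomial.degreeLT Fq d) :=
    Finite.of_equiv _ (Polynomial.degreeLTEquiv Fq d).toEquiv.symm
  (Set.toFinite (Polynomial.degreeLT Fq d : Set Fq[X])).toFinset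

lemma mem_polyLT {d : ℕ} {a : Fq[X]} : a ∈ polyLT Fq d ↔ a.degree < d := by
  simp [polyLT, Polynomial.mem_degreeLT]

lemma card_polyLT (d : ℕ) : (polyLT Fq d).card = qCard Fq ^ d := by
  have : Finite (Polynomial.degreeLT Fq d) :=
    Finite.of_equiv _ (Polynomial.degreeLTEquiv Fq d).toEquiv.symm
  rw [polyLT, ← Set.ncard_eq_toFinset_card _]
  change Nat.card (Polynomial.degreeLT Fq d) = _
  rw [Nat.card_congr (Polynomial.degreeLTEquiv Fq d).toEquiv]
  simp

lemma polyLT_mono : Monotone (polyLT Fq) := fun d e h a ha => by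
  rw [mem_polyLT] at ha ⊢
  exact ha.trans_le (by exact_mod_cast h)

lemma tendsto_polyLT : Tendsto (polyLT Fq) atTop atTop :=
  tendsto_atTop_finset_of_monotone polyLT_mono fun a => ⟨a.natDegree + 1, by
    rw [mem_polyLT]
    exact Polynomial.degree_le_natDegree.trans_lt (by exact_mod_cast Nat.lt_succ_self _)⟩

lemma tendsto_norm_ofA_cofinite : Tendsto (fun a : Fq[X] => ‖ofA Fq a‖) cofinite atTop := by
  rw [tendsto_atTop]
  intro B
  obtain ⟨n, hn⟩ := pow_unbounded_of_one_lt B (one_lt_qCard Fq)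
  rw [eventually_cofinite]
  refine (polyLT Fq n).finite_toSet.subset fun a ha => ?_
  rw [Set.mem_ofPred_eq, not_le] at ha
  rw [Finset.mem_coe, mem_polyLT]
  rcases eq_or_ne a 0 with rfl | h0
  · simp
  rw [norm_ofA h0] at ha
  rw [← Polynomial.natDegree_lt_iff_degree_lt h0]
  exact (pow_lt_pow_iff_right₀ (one_lt_qCard Fq)).1 (ha.trans hn)

/-! ### The imaginary part -/

lemma imagPart_le (z : CInf Fq) (x : KInf Fq) : imagPart z ≤ ‖z - ofKInf Fq x‖ :=
  ciInf_le ⟨0, by rintro _ ⟨y, rfl⟩; exact norm_nonneg _⟩ x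

lemma imagPart_le_norm_sub_ofA (z : CInf Fq) (a : Fq[X]) : imagPart z ≤ ‖z - ofA Fq a‖ :=
  imagPart_le z (polyToKInf Fq a)

lemma imagPart_add_ofA (z : CInf Fq) (a : Fq[X]) : imagPart (z + ofA Fq a) = imagPart z := by
  refine Equiv.iInf_congr (Equiv.addRight (-polyToKInf Fq a)) fun x => ?_
  rw [Equiv.coe_addRight, map_add, map_neg]
  congr 1
  change _ = z + ofKInf Fq (polyToKInf Fq a) - _
  ring

lemma imagPart_add {z x : CInf Fq} (h : ‖x‖ < imagPart z) : imagPart (z + x) = imagPart z := by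
  refine iInf_congr fun y => norm_eq_of_norm_sub_lt ?_
  have := imagPart_le z y
  rw [show z + x - ofKInf Fq y - (z - ofKInf Fq y) = x by ring]
  linarith

lemma mem_Omega_of_imagPart_pos {z : CInf Fq} (h : 0 < imagPart z) : z ∈ Omega Fq := by
  rintro ⟨x, rfl⟩
  have := imagPart_le (ofKInf Fq x) x
  simp at this
  linarith

lemma imagPart_pos {z : CInf Fq} (hz : z ∈ Omega Fq) : 0 < imagPart z := by
  -- Completeness of `K_∞` makes its image closed, so a point outside it has positive distance from
  -- it.
  have hcl : IsClosed (Set.range (ofKInf Fq)) :=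
    isometry_ofKInf.isUniformInducing.isComplete_range.isClosed
  have hz' : (Set.range (ofKInf Fq))ᶜ ∈ 𝓝 z := hcl.isOpen_compl.mem_nhds hz
  obtain ⟨ε, hε, h⟩ := Metric.mem_nhds_iff.1 hz'
  refine hε.trans_le (le_ciInf fun x => ?_)
  by_contra! hlt
  exact h (by rwa [Metric.mem_ball, dist_eq_norm, norm_sub_rev] : ofKInf Fq x ∈ Metric.ball z ε)
    ⟨x, rfl⟩

lemma norm_lt_imagPart_add_mem {z x : CInf Fq} (h : ‖x‖ < imagPart z) : z + x ∈ Omega Fq :=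
  mem_Omega_of_imagPart_pos (by rw [imagPart_add h]; exact (norm_nonneg x).trans_lt h)

/-- With `s ^ 2 = θ`, the norm of `s * θ ^ n` is a half-integral power of `q`, hence not the norm of
an element of `K_∞`. No such element can therefore approximate `s * θ ^ n` better than `0` does, and
its imaginary part equals its norm. -/
lemma exists_lt_imagPart (R : ℝ) : ∃ z : Omega Fq, R < imagPart (z : CInf Fq) := by
  obtain ⟨s, hs⟩ := IsAlgClosed.exists_pow_nat_eq (theta Fq) two_pos
  have hq := one_lt_qCard Fq
  have hsn : ‖s‖ ^ 2 = qCard Fq := by rw [← norm_pow, hs, norm_theta]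
  have hs1 : 1 ≤ ‖s‖ := by nlinarith [norm_nonneg s]
  obtain ⟨n, hn⟩ := pow_unbounded_of_one_lt R hq
  have key : ‖s * theta Fq ^ n‖ ≤ imagPart (s * theta Fq ^ n) := by
    refine le_ciInf fun x => ?_
    by_contra! hlt
    rw [norm_sub_rev] at hlt
    have h1 := norm_eq_of_norm_sub_lt hlt
    have hx : x ≠ 0 := by
      rintro rfl
      simp at hlt
    obtain ⟨m, hm⟩ := exists_norm_KInf_eq_zpow hx
    rw [norm_ofKInf, hm, norm_mul, norm_pow, norm_theta] at h1
    have h2 : ((qCard Fq : ℝ) ^ m) ^ 2 = (qCard Fq : ℝ) ^ (2 * n + 1 : ℤ) := by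
      rw [h1, mul_pow, hsn, zpow_add₀ (by positivity), zpow_mul, zpow_one]
      norm_cast
      ring
    rw [← zpow_natCast, ← zpow_mul] at h2
    have := zpow_right_injective₀ (by linarith) hq.ne' h2
    push_cast at this
    omega
  have h3 : R < ‖s * theta Fq ^ n‖ := by
    rw [norm_mul, norm_pow, norm_theta]
    have : 0 < (qCard Fq : ℝ) ^ n := by positivity
    nlinarith
  have h4 : 0 < ‖s * theta Fq ^ n‖ := by
    rw [norm_mul, norm_pow, norm_theta]; positivity
  exact ⟨⟨_, mem_Omega_of_imagPart_pos (h4.trans_le key)⟩, h3.trans_le key⟩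

lemma exists_mem_affinoid (z : Omega Fq) : ∃ n, (z : CInf Fq) ∈ affinoid Fq n := by
  have hq := one_lt_qCard Fq
  obtain ⟨n, hn⟩ := pow_unbounded_of_one_lt (max ‖(z : CInf Fq)‖ (imagPart (z : CInf Fq))⁻¹) hq
  refine ⟨n, ((le_max_left _ _).trans_lt hn).le, ?_⟩
  rw [inv_le_comm₀ (by positivity) (imagPart_pos z.2)]
  exact ((le_max_right _ _).trans_lt hn).le

lemma affinoid_subset_Omega {n : ℕ} {z : CInf Fq} (hz : z ∈ affinoid Fq n) : z ∈ Omega Fq :=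
  mem_Omega_of_imagPart_pos (lt_of_lt_of_le
    (inv_pos.2 (pow_pos (zero_lt_one.trans (one_lt_qCard Fq)) n)) hz.2)

/-- This gives all points of `Ω_n` discs of one common radius, on which rational approximants have
no poles. -/
lemma affinoid_add {n : ℕ} {z x : CInf Fq} (hz : z ∈ affinoid Fq n)
    (hx : ‖x‖ < ((qCard Fq : ℝ) ^ n)⁻¹) : z + x ∈ affinoid Fq n := by
  have hq := one_lt_qCard Fq
  have h1 : 1 ≤ (qCard Fq : ℝ) ^ n := one_le_pow₀ hq.le
  refine ⟨(IsUltrametricDist.norm_add_le_max _ _).trans (max_le hz.1 ?_), ?_⟩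
  · exact hx.le.trans ((inv_le_one_of_one_le₀ h1).trans h1)
  · rw [imagPart_add (hx.trans_le hz.2)]; exact hz.2

end CInf

/-! ## The linear polynomials attached to polynomials of bounded degree -/

section FrobeniusPower

variable {Fq : Type*} [Field Fq] [Fintype Fq] {R : Type*} [CommRing R]

variable (Fq) in
lemma exists_qCard_eq_pow : ∃ n : ℕ, qCard Fq = ringChar Fq ^ n :=
  ⟨_, (FiniteField.card Fq (ringChar Fq)).choose_spec.2⟩

variable (Fq R) in
/-- The ring endomorphism `x ↦ x ^ q`. -/
noncomputable def frobQ [CharP R (ringChar Fq)] : R →+* R :=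
  iterateFrobenius R (ringChar Fq) (exists_qCard_eq_pow Fq).choose

lemma frobQ_apply [CharP R (ringChar Fq)] (x : R) : frobQ Fq R x = x ^ qCard Fq := by
  rw [frobQ, iterateFrobenius_def, ← (exists_qCard_eq_pow Fq).choose_spec]

end FrobeniusPower

section CarlitzPolynomials

variable (Fq : Type*) [Field Fq] [Fintype Fq]

/-- `[i] = θ ^ (q ^ i) - θ`. -/
noncomputable def bracket (i : ℕ) : CInf Fq := theta Fq ^ qCard Fq ^ i - theta Fq

/-- `D_i`, as an element of `ℂ_∞`. -/
noncomputable def dElem (i : ℕ) : CInf Fq := ofA Fq (carlitzD Fq i)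

/-- `L_i = [i] ⋯ [1]`. -/
noncomputable def lElem (i : ℕ) : CInf Fq := ∏ j ∈ Finset.range i, bracket Fq (j + 1)

/-- The coefficients of the normalised `𝔽_q`-linear polynomials vanishing on the polynomials of
degree less than `d`. -/
noncomputable def linCoeff : ℕ → ℕ → CInf Fq
  | 0, 0 => 1
  | 0, _ + 1 => 0
  | d + 1, 0 => linCoeff d 0
  | d + 1, i + 1 => linCoeff d (i + 1) - linCoeff d i ^ qCard Fq / lElem Fq d ^ (qCard Fq - 1)

/-- The polynomial `z ∏ (1 - z / a)`, `a ≠ 0` of degree less than `d`. -/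
noncomputable def linPoly : ℕ → (CInf Fq)[X]
  | 0 => Polynomial.X
  | d + 1 => linPoly d -
      Polynomial.C (lElem Fq d ^ (qCard Fq - 1))⁻¹ * linPoly d ^ qCard Fq

variable {Fq}

lemma qCard_pos : 0 < qCard Fq := Fintype.card_pos
lemma one_lt_qCard_nat : 1 < qCard Fq := Fintype.one_lt_card

lemma bracket_zero : bracket Fq 0 = 0 := by simp [bracket]

lemma bracket_pow (i : ℕ) :
    bracket Fq i ^ qCard Fq = theta Fq ^ qCard Fq ^ (i + 1) - theta Fq ^ qCard Fq := by
  rw [← frobQ_apply, bracket, map_sub, frobQ_apply, frobQ_apply, ← pow_mul, pow_succ]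

lemma norm_bracket_succ (i : ℕ) :
    ‖bracket Fq (i + 1)‖ = (qCard Fq : ℝ) ^ qCard Fq ^ (i + 1) := by
  have hq := one_lt_qCard Fq
  have h : ‖bracket Fq (i + 1)‖ = ‖theta Fq ^ qCard Fq ^ (i + 1)‖ := by
    refine norm_eq_of_norm_sub_lt ?_
    rw [bracket, sub_sub_cancel_left, norm_neg, norm_pow, norm_theta]
    exact lt_self_pow₀ hq (Nat.one_lt_pow (by omega) one_lt_qCard_nat)
  rw [h, norm_pow, norm_theta]

lemma bracket_succ_ne_zero (i : ℕ) : bracket Fq (i + 1) ≠ 0 := by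
  rw [← norm_pos_iff, norm_bracket_succ]
  have := one_lt_qCard Fq
  positivity

lemma theta_ne_zero : theta Fq ≠ 0 := by
  rw [← norm_pos_iff, norm_theta]
  have := one_lt_qCard Fq
  positivity

lemma dElem_zero : dElem Fq 0 = 1 := by simp [dElem, carlitzD]

lemma dElem_succ (i : ℕ) : dElem Fq (i + 1) = bracket Fq (i + 1) * dElem Fq i ^ qCard Fq := by
  simp [dElem, carlitzD, bracket, theta]

lemma lElem_zero : lElem Fq 0 = 1 := by simp [lElem]

lemma lElem_succ (i : ℕ) : lElem Fq (i + 1) = bracket Fq (i + 1) * lElem Fq i := by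
  rw [lElem, Finset.prod_range_succ, mul_comm, lElem]

lemma lElem_ne_zero (i : ℕ) : lElem Fq i ≠ 0 :=
  Finset.prod_ne_zero_iff.2 fun j _ => bracket_succ_ne_zero j

lemma norm_dElem (i : ℕ) : ‖dElem Fq i‖ = (qCard Fq : ℝ) ^ (i * qCard Fq ^ i) := by
  induction i with
  | zero => simp [dElem_zero]
  | succ i ih =>
    rw [dElem_succ, norm_mul, norm_pow, ih, norm_bracket_succ, ← pow_mul, ← pow_add]
    congr 1
    ring

lemma linCoeff_zero_right (d : ℕ) : linCoeff Fq d 0 = 1 := by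
  induction d with
  | zero => rw [linCoeff]
  | succ d ih => rw [linCoeff, ih]

lemma linCoeff_succ_succ (d i : ℕ) : linCoeff Fq (d + 1) (i + 1) =
    linCoeff Fq d (i + 1) - linCoeff Fq d i ^ qCard Fq / lElem Fq d ^ (qCard Fq - 1) := by
  rw [linCoeff]

lemma linCoeff_eq_zero {d i : ℕ} (h : d < i) : linCoeff Fq d i = 0 := by
  induction d generalizing i with
  | zero => obtain ⟨i, rfl⟩ := Nat.exists_eq_succ_of_ne_zero h.ne'; rw [linCoeff]
  | succ d ih =>
    obtain ⟨i, rfl⟩ := Nat.exists_eq_succ_of_ne_zero (by omega : i ≠ 0)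
    rw [linCoeff, ih (by omega), ih (by omega), zero_pow qCard_pos.ne', zero_div, sub_zero]

/-- This is the functional equation `eval_linPoly_theta_mul` at the level of coefficients. The
inductive step combines the identity at `(d, i + 1)` with the `q`-th power of the one at `(d, i)`;
Frobenius turns `[i]` into `[i + 1] - [1]`. -/
lemma bracket_mul_linCoeff (d i : ℕ) :
    bracket Fq i * linCoeff Fq (d + 1) i =
      bracket Fq (d + 1) * (linCoeff Fq (d + 1) i - linCoeff Fq d i) := by
  induction d generalizing i with
  | zero =>
    rcases i with _ | _ | i
    · simp [bracket_zero, linCoeff_zero_right]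
    · simp [linCoeff]
    · simp [linCoeff_eq_zero]
  | succ d ih =>
    rcases i with _ | i
    · simp [bracket_zero, linCoeff_zero_right]
    have h1 := ih (i + 1)
    have h2 := congrArg (· ^ qCard Fq) (ih i)
    simp only [← frobQ_apply (Fq := Fq), map_mul, map_sub] at h2
    simp only [frobQ_apply, bracket_pow] at h2
    rw [linCoeff_succ_succ (d + 1)]
    rw [linCoeff_succ_succ d] at h1 ⊢
    have hℓ : lElem Fq (d + 1) ^ (qCard Fq - 1) * bracket Fq (d + 1) =
        bracket Fq (d + 1) ^ qCard Fq * lElem Fq d ^ (qCard Fq - 1) := by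
      rw [lElem_succ, mul_pow, ← Nat.sub_add_cancel (qCard_pos (Fq := Fq)), pow_succ]
      simp only [Nat.add_sub_cancel]
      ring
    rw [bracket_pow] at hℓ
    have hb := bracket_succ_ne_zero (Fq := Fq) d
    have hl := pow_ne_zero (qCard Fq - 1) (lElem_ne_zero (Fq := Fq) d)
    have hl' := pow_ne_zero (qCard Fq - 1) (lElem_ne_zero (Fq := Fq) (d + 1))
    generalize lElem Fq (d + 1) ^ (qCard Fq - 1) = ℓ' at *
    generalize lElem Fq d ^ (qCard Fq - 1) = ℓ at *
    generalize linCoeff Fq (d + 1) i ^ qCard Fq = u at *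
    generalize linCoeff Fq d i ^ qCard Fq = v at *
    generalize linCoeff Fq d (i + 1) = w at *
    have e1 : bracket Fq (i + 1) = theta Fq ^ qCard Fq ^ (i + 1) - theta Fq := rfl
    have e2 : bracket Fq (d + 1 + 1) = theta Fq ^ qCard Fq ^ (d + 1 + 1) - theta Fq := rfl
    -- Eliminating the power of `L_{d+1}` in favour of that of `L_d` reduces the claim to an
    -- identity of rational expressions.
    have e3 : ℓ' = (theta Fq ^ qCard Fq ^ (d + 1 + 1) - theta Fq ^ qCard Fq) * ℓ /
      bracket Fq (d + 1) := by rw [← hℓ]; field_simp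
    set b := bracket Fq (d + 1)
    set s := theta Fq ^ qCard Fq ^ (d + 1 + 1)
    set t := theta Fq ^ qCard Fq ^ (i + 1)
    set θq := theta Fq ^ qCard Fq
    have hs : s - θq ≠ 0 := by
      intro h0; rw [e3, h0] at hl'; simp at hl'
    have h1' : (bracket Fq (i + 1)) * (w - v / ℓ) = - (b * v / ℓ) := by
      rw [h1]; ring
    have h3 : (t - s) * u = - ((s - θq) * v) := by linear_combination h2
    have h4 : (t - s) * (u / ℓ') = - (b * v / ℓ) := by
      rw [e3]
      field_simp
      linear_combination h3
    rw [mul_sub, h1']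
    rw [← h4, e1, e2]
    ring

lemma bracket_mul_linCoeff_succ (d i : ℕ) :
    bracket Fq (i + 1) * linCoeff Fq (d + 1) (i + 1) =
      -(bracket Fq (d + 1) / lElem Fq d ^ (qCard Fq - 1)) * linCoeff Fq d i ^ qCard Fq := by
  rw [bracket_mul_linCoeff, linCoeff_succ_succ]
  ring

lemma eval_linPoly (d : ℕ) (z : CInf Fq) :
    (linPoly Fq d).eval z =
      ∑ i ∈ Finset.range (d + 1), linCoeff Fq d i * z ^ qCard Fq ^ i := by
  induction d with
  | zero => simp [linPoly, linCoeff]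
  | succ d ih =>
    rw [linPoly, Polynomial.eval_sub, Polynomial.eval_mul, Polynomial.eval_C, Polynomial.eval_pow,
      ih, ← frobQ_apply, map_sum, Finset.sum_range_succ' _ (d + 1), linCoeff_zero_right]
    simp only [linCoeff_succ_succ, sub_mul, Finset.sum_sub_distrib]
    have hshift : ∑ i ∈ Finset.range (d + 1), linCoeff Fq d i * z ^ qCard Fq ^ i =
        ∑ i ∈ Finset.range (d + 1), linCoeff Fq d (i + 1) * z ^ qCard Fq ^ (i + 1) +
          z ^ qCard Fq ^ 0 := by
      rw [Finset.sum_range_succ', linCoeff_zero_right, one_mul,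
        Finset.sum_range_succ _ d, linCoeff_eq_zero (Nat.lt_succ_self d), zero_mul, add_zero]
    rw [hshift, Finset.mul_sum, one_mul]
    simp only [map_mul, map_pow, frobQ_apply]
    have : ∀ i, (lElem Fq d ^ (qCard Fq - 1))⁻¹ *
        (linCoeff Fq d i ^ qCard Fq * (z ^ qCard Fq) ^ qCard Fq ^ i) =
        linCoeff Fq d i ^ qCard Fq / lElem Fq d ^ (qCard Fq - 1) * z ^ qCard Fq ^ (i + 1) := by
      intro i
      rw [← pow_mul, ← pow_succ']; ring
    simp only [this]
    ring

lemma aeval_linPoly_add {R : Type*} [CommRing R] [Algebra (CInf Fq) R] [CharP R (ringChar Fq)]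
    (d : ℕ) (x y : R) : Polynomial.aeval (x + y) (linPoly Fq d) =
      Polynomial.aeval x (linPoly Fq d) + Polynomial.aeval y (linPoly Fq d) := by
  induction d with
  | zero => simp [linPoly]
  | succ d ih =>
    simp only [linPoly, map_sub, map_mul, map_pow, Polynomial.aeval_C, ih]
    rw [← frobQ_apply (Fq := Fq), map_add, frobQ_apply, frobQ_apply]
    ring

lemma aeval_linPoly_sub {R : Type*} [CommRing R] [Algebra (CInf Fq) R] [CharP R (ringChar Fq)]
    (d : ℕ) (x y : R) : Polynomial.aeval (x - y) (linPoly Fq d) =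
      Polynomial.aeval x (linPoly Fq d) - Polynomial.aeval y (linPoly Fq d) := by
  rw [eq_sub_iff_add_eq, ← aeval_linPoly_add, sub_add_cancel]

lemma eval_linPoly_const_mul (d : ℕ) (c : Fq) (x : CInf Fq) :
    (linPoly Fq d).eval (ofA Fq (Polynomial.C c) * x) =
      ofA Fq (Polynomial.C c) * (linPoly Fq d).eval x := by
  induction d with
  | zero => simp [linPoly]
  | succ d ih =>
    have hc : ofA Fq (Polynomial.C c) ^ qCard Fq = ofA Fq (Polynomial.C c) := by
      rw [← map_pow, ← map_pow, FiniteField.pow_card]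
    simp only [linPoly, Polynomial.eval_sub, Polynomial.eval_mul, Polynomial.eval_pow, ih,
      Polynomial.eval_C, mul_pow, hc]
    ring

lemma eval_linPoly_theta_mul (d : ℕ) (z : CInf Fq) :
    (linPoly Fq (d + 1)).eval (theta Fq * z) = theta Fq * (linPoly Fq (d + 1)).eval z +
      bracket Fq (d + 1) * ((linPoly Fq (d + 1)).eval z - (linPoly Fq d).eval z) := by
  have h : (linPoly Fq d).eval z =
      ∑ i ∈ Finset.range (d + 1 + 1), linCoeff Fq d i * z ^ qCard Fq ^ i := by
    rw [Finset.sum_range_succ, linCoeff_eq_zero (Nat.lt_succ_self d), zero_mul, add_zero,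
      eval_linPoly]
  rw [h, eval_linPoly, eval_linPoly, ← Finset.sum_sub_distrib, Finset.mul_sum, Finset.mul_sum,
    ← Finset.sum_add_distrib]
  refine Finset.sum_congr rfl fun i _ => ?_
  rw [← sub_mul, ← mul_assoc (bracket Fq (d + 1)), ← bracket_mul_linCoeff, bracket]
  ring

/-- The functional equation under `z ↦ θ z` passes from the zero `θ ^ j` of both `E_d` and `E_{d+1}`
to the zero `θ ^ (j + 1)` of `E_{d+1}`. The start is `E_1(1) = 0`, which the recursion then
propagates to all larger indices. -/
lemma eval_linPoly_theta_pow {d j : ℕ} (h : j < d) : (linPoly Fq d).eval (theta Fq ^ j) = 0 := by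
  induction j generalizing d with
  | zero =>
    induction d with
    | zero => omega
    | succ d ih =>
      rcases Nat.eq_zero_or_pos d with rfl | hd
      · simp [linPoly, lElem_zero]
      · simp only [linPoly, Polynomial.eval_sub, Polynomial.eval_mul, Polynomial.eval_pow, ih hd,
          zero_pow qCard_pos.ne', mul_zero, sub_zero]
  | succ j ih =>
    obtain ⟨d, rfl⟩ := Nat.exists_eq_succ_of_ne_zero (by omega : d ≠ 0)
    rw [pow_succ', eval_linPoly_theta_mul, ih (by omega), ih (by omega)]
    simp

lemma eval_linPoly_ofA {d : ℕ} {a : Fq[X]} (h : a ∈ polyLT Fq d) :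
    (linPoly Fq d).eval (ofA Fq a) = 0 := by
  rw [mem_polyLT] at h
  rcases eq_or_ne a 0 with rfl | h0
  · rw [map_zero, eval_linPoly]
    exact Finset.sum_eq_zero fun i _ => by rw [zero_pow (pow_pos qCard_pos i).ne', mul_zero]
  have hadd : ∀ s : Finset ℕ, ∀ f : ℕ → CInf Fq, (linPoly Fq d).eval (∑ i ∈ s, f i) =
      ∑ i ∈ s, (linPoly Fq d).eval (f i) := fun s f => by
    let φ : CInf Fq →+ CInf Fq := AddMonoidHom.mk' (fun x => (linPoly Fq d).eval x) fun x y => by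
      simpa [Polynomial.coe_aeval_eq_eval] using aeval_linPoly_add d x y
    exact map_sum φ f s
  rw [a.as_sum_range_C_mul_X_pow' (n := d) ?_, map_sum, hadd]
  · refine Finset.sum_eq_zero fun i hi => ?_
    rw [map_mul, eval_linPoly_const_mul, map_pow]
    change _ * (linPoly Fq d).eval (theta Fq ^ i) = 0
    rw [eval_linPoly_theta_pow (Finset.mem_range.1 hi), mul_zero]
  · exact (Polynomial.natDegree_lt_iff_degree_lt h0).2 h

lemma natDegree_linPoly_le (d : ℕ) : (linPoly Fq d).natDegree ≤ qCard Fq ^ d := by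
  induction d with
  | zero => simp [linPoly]
  | succ d ih =>
    rw [linPoly]
    refine (Polynomial.natDegree_sub_le _ _).trans (max_le ?_ ?_)
    · exact ih.trans (Nat.pow_le_pow_right qCard_pos (Nat.le_succ d))
    · refine (Polynomial.natDegree_C_mul_le _ _).trans (Polynomial.natDegree_pow_le.trans ?_)
      rw [pow_succ']
      exact Nat.mul_le_mul_left _ ih

lemma qCard_cast_eq_zero : (qCard Fq : CInf Fq) = 0 := by
  have : (qCard Fq : Fq) = 0 := Nat.cast_card_eq_zero Fq
  rw [← map_natCast ((ofA Fq).comp Polynomial.C), this, map_zero]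

/-- Each recursion step subtracts a constant multiple of a `q`-th power, whose derivative is zero.
This makes the logarithmic derivative of `E_d` equal to `1 / E_d`. -/
lemma derivative_linPoly (d : ℕ) : Polynomial.derivative (linPoly Fq d) = 1 := by
  induction d with
  | zero => simp [linPoly]
  | succ d ih =>
    rw [linPoly, Polynomial.derivative_sub, ih, Polynomial.derivative_C_mul,
      Polynomial.derivative_pow, qCard_cast_eq_zero]
    simp

/-- Both sides have degree at most `q ^ d` and vanish at the `q ^ d` polynomials of degree less than
`d`. With `κ` the coefficient in degree `q ^ d`, the difference has too many zeros. -/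
lemma exists_linPoly_eq (d : ℕ) : ∃ κ : CInf Fq,
    linPoly Fq d = Polynomial.C κ * ∏ a ∈ polyLT Fq d, (Polynomial.X - Polynomial.C (ofA Fq a)) := by
  classical
  set P := ∏ a ∈ polyLT Fq d, (Polynomial.X - Polynomial.C (ofA Fq a)) with hP
  have hmon : P.Monic := Polynomial.monic_prod_X_sub_C _ _
  have hdeg : P.natDegree = qCard Fq ^ d := by
    rw [hP, Polynomial.natDegree_prod_of_monic _ _ fun a _ => Polynomial.monic_X_sub_C _]
    simp [card_polyLT]
  refine ⟨(linPoly Fq d).coeff (qCard Fq ^ d), ?_⟩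
  rw [← sub_eq_zero]
  refine Polynomial.eq_zero_of_degree_lt_of_eval_finset_eq_zero
    ((polyLT Fq d).image (ofA Fq)) ?_ ?_
  · rw [Finset.card_image_of_injective _ ofA_injective, card_polyLT,
      Polynomial.degree_lt_iff_coeff_zero]
    intro m hm
    rw [Polynomial.coeff_sub, Polynomial.coeff_C_mul]
    rcases hm.eq_or_lt with rfl | hlt
    · rw [← hdeg, hmon.coeff_natDegree, mul_one, sub_self]
    · rw [Polynomial.coeff_eq_zero_of_natDegree_lt ((natDegree_linPoly_le d).trans_lt hlt),
        Polynomial.coeff_eq_zero_of_natDegree_lt (hdeg.trans_lt hlt), mul_zero, sub_zero]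
  · intro x hx
    obtain ⟨a, ha, rfl⟩ := Finset.mem_image.1 hx
    rw [Polynomial.eval_sub, eval_linPoly_ofA ha, hP, Polynomial.eval_mul, Polynomial.eval_prod,
      Finset.prod_eq_zero ha (by simp)]
    simp

end CarlitzPolynomials

/-! ## The Carlitz period and the exponential function -/

section

variable {Fq : Type*} [Field Fq] [Fintype Fq]

section Period

/-- The factors `(1 - θ ^ (1 - q ^ (i + 1)))⁻¹` of the Carlitz period. -/
noncomputable def periodFactor (Fq : Type*) [Field Fq] [Fintype Fq] (i : ℕ) : CInf Fq :=
  (1 - theta Fq ^ ((1 : ℤ) - (qCard Fq : ℤ) ^ (i + 1)))⁻¹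

lemma theta_zpow_eq (i : ℕ) : theta Fq ^ ((1 : ℤ) - (qCard Fq : ℤ) ^ (i + 1)) =
    theta Fq / theta Fq ^ qCard Fq ^ (i + 1) := by
  rw [zpow_sub₀ theta_ne_zero, zpow_one]
  norm_cast

lemma bracket_mul_periodFactor (i : ℕ) :
    bracket Fq (i + 1) * periodFactor Fq i = theta Fq ^ qCard Fq ^ (i + 1) := by
  have h0 := bracket_succ_ne_zero (Fq := Fq) i
  have h1 := theta_ne_zero (Fq := Fq)
  have h2 : 1 - theta Fq / theta Fq ^ qCard Fq ^ (i + 1) =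
      bracket Fq (i + 1) / theta Fq ^ qCard Fq ^ (i + 1) := by
    rw [bracket]; field_simp
  rw [periodFactor, theta_zpow_eq, h2, inv_div]
  field_simp

lemma norm_periodFactor (i : ℕ) : ‖periodFactor Fq i‖ = 1 := by
  have h := congrArg norm (bracket_mul_periodFactor (Fq := Fq) i)
  rw [norm_mul, norm_bracket_succ, norm_pow, norm_theta] at h
  have hq := one_lt_qCard Fq
  exact mul_left_cancel₀ (by positivity) (h.trans (mul_one _).symm)

lemma tendsto_theta_zpow :
    Tendsto (fun i => theta Fq ^ ((1 : ℤ) - (qCard Fq : ℤ) ^ (i + 1))) atTop (𝓝 0) := by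
  have hq := one_lt_qCard Fq
  have h : Tendsto (fun i : ℕ => (qCard Fq : ℝ) * (qCard Fq : ℝ)⁻¹ ^ i) atTop (𝓝 0) := by
    simpa using (tendsto_pow_atTop_nhds_zero_of_lt_one (by positivity)
      (inv_lt_one_of_one_lt₀ hq)).const_mul (qCard Fq : ℝ)
  refine squeeze_zero_norm (fun i => ?_) h
  rw [theta_zpow_eq, norm_div, norm_pow, norm_theta, div_eq_mul_inv, ← inv_pow]
  refine mul_le_mul_of_nonneg_left ?_ (by positivity)
  refine pow_le_pow_of_le_one (by positivity) (inv_le_one_of_one_le₀ hq.le) ?_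
  exact (Nat.lt_succ_self i).le.trans (Nat.lt_pow_self one_lt_qCard_nat).le

lemma tendsto_periodFactor : Tendsto (periodFactor Fq) atTop (𝓝 1) := by
  have h := (tendsto_theta_zpow (Fq := Fq)).const_sub 1
  rw [sub_zero] at h
  have h2 := h.inv₀ one_ne_zero
  rwa [inv_one] at h2

lemma multipliable_periodFactor : Multipliable (periodFactor Fq) := by
  have h : Tendsto (fun i => periodFactor Fq i - 1) cofinite (𝓝 0) := by
    rw [Nat.cofinite_eq_atTop]
    simpa using (tendsto_periodFactor (Fq := Fq)).sub_const 1
  simpa using multipliable_one_add_of_tendsto_cofinite h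

lemma tendsto_prod_periodFactor : Tendsto (fun n => ∏ i ∈ Finset.range n, periodFactor Fq i) atTop
    (𝓝 (∏' i, periodFactor Fq i)) :=
  (multipliable_periodFactor (Fq := Fq)).hasProd.tendsto_prod_nat

/-- Each bracket times its period factor is a pure power of `θ`, and the exponents telescope: `(q -
1)(q + ⋯ + q ^ d) = q ^ (d + 1) - q`. This brings the product for `π̃` into the recursion of the
`E_d`. -/
lemma lElem_pow_mul_prod_periodFactor (d : ℕ) :
    lElem Fq d ^ (qCard Fq - 1) * (∏ i ∈ Finset.range d, periodFactor Fq i) ^ (qCard Fq - 1) *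
      theta Fq ^ qCard Fq = theta Fq ^ qCard Fq ^ (d + 1) := by
  induction d with
  | zero => simp [lElem_zero]
  | succ d ih =>
    rw [lElem_succ, Finset.prod_range_succ]
    calc _ = (bracket Fq (d + 1) * periodFactor Fq d) ^ (qCard Fq - 1) *
          (lElem Fq d ^ (qCard Fq - 1) *
            (∏ i ∈ Finset.range d, periodFactor Fq i) ^ (qCard Fq - 1) * theta Fq ^ qCard Fq) := by
          simp only [mul_pow]; ring
      _ = _ := by
          rw [ih, bracket_mul_periodFactor, ← pow_succ, Nat.sub_add_cancel qCard_pos, ← pow_mul,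
            ← pow_succ]

/-- The factor of the recursion of the coefficients `linCoeff`. -/
noncomputable def recFactor (Fq : Type*) [Field Fq] [Fintype Fq] (d : ℕ) : CInf Fq :=
  -(bracket Fq (d + 1) / lElem Fq d ^ (qCard Fq - 1))

lemma recFactor_eq (d : ℕ) : recFactor Fq d = -theta Fq ^ qCard Fq * (periodFactor Fq d)⁻¹ *
    (∏ i ∈ Finset.range d, periodFactor Fq i) ^ (qCard Fq - 1) := by
  have h1 := lElem_pow_mul_prod_periodFactor (Fq := Fq) d
  rw [← bracket_mul_periodFactor] at h1
  have h2 : periodFactor Fq d ≠ 0 := by rw [← norm_pos_iff, norm_periodFactor]; exact one_pos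
  have h3 := pow_ne_zero (qCard Fq - 1) (lElem_ne_zero (Fq := Fq) d)
  rw [recFactor]
  field_simp
  linear_combination h1

/-- The norm does not depend on `d`, so it is also the norm of the limit `π̃ ^ (q - 1)`. This yields
both the size of the period and the uniform bound `norm_linCoeff_le`. -/
lemma norm_recFactor (d : ℕ) : ‖recFactor Fq d‖ = (qCard Fq : ℝ) ^ qCard Fq := by
  rw [recFactor_eq, norm_mul, norm_mul, norm_neg, norm_pow, norm_theta, norm_inv, norm_pow,
    norm_prod]
  simp [norm_periodFactor]

variable {ρ : CInf Fq}

lemma carlitzPeriod_pow (hρ : ρ ^ (qCard Fq - 1) = -theta Fq) :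
    carlitzPeriod ρ ^ (qCard Fq - 1) =
      -theta Fq ^ qCard Fq * (∏' i, periodFactor Fq i) ^ (qCard Fq - 1) := by
  have : theta Fq ^ qCard Fq = theta Fq ^ (qCard Fq - 1) * theta Fq := by
    rw [← pow_succ, Nat.sub_add_cancel qCard_pos]
  change (theta Fq * ρ * ∏' i, periodFactor Fq i) ^ (qCard Fq - 1) = _
  rw [mul_pow, mul_pow, hρ, this]
  ring

lemma tendsto_recFactor (hρ : ρ ^ (qCard Fq - 1) = -theta Fq) :
    Tendsto (recFactor Fq) atTop (𝓝 (carlitzPeriod ρ ^ (qCard Fq - 1))) := by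
  rw [carlitzPeriod_pow hρ, funext recFactor_eq]
  have h1 := (tendsto_periodFactor (Fq := Fq)).inv₀ one_ne_zero
  have h2 := (tendsto_prod_periodFactor (Fq := Fq)).pow (qCard Fq - 1)
  simpa using (h1.const_mul (-theta Fq ^ qCard Fq)).mul h2

lemma norm_carlitzPeriod_pow (hρ : ρ ^ (qCard Fq - 1) = -theta Fq) :
    ‖carlitzPeriod ρ‖ ^ (qCard Fq - 1) = (qCard Fq : ℝ) ^ qCard Fq := by
  rw [← norm_pow]
  refine tendsto_nhds_unique (tendsto_recFactor hρ).norm ?_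
  simp only [norm_recFactor]
  exact tendsto_const_nhds

lemma norm_carlitzPeriod_pos (hρ : ρ ^ (qCard Fq - 1) = -theta Fq) : 0 < ‖carlitzPeriod ρ‖ := by
  have h := norm_carlitzPeriod_pow hρ
  have hq := one_lt_qCard Fq
  have h1 : 0 < (qCard Fq : ℝ) ^ qCard Fq := by positivity
  rw [← h] at h1
  by_contra h0
  have h2 : ‖carlitzPeriod ρ‖ = 0 := le_antisymm (not_lt.1 h0) (norm_nonneg _)
  rw [h2, zero_pow (by have := one_lt_qCard_nat (Fq := Fq); omega)] at h1
  exact lt_irrefl _ h1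

lemma carlitzPeriod_ne_zero (hρ : ρ ^ (qCard Fq - 1) = -theta Fq) : carlitzPeriod ρ ≠ 0 :=
  norm_pos_iff.1 (norm_carlitzPeriod_pos hρ)

end Period

/-! ### The exponential of `A` as a limit of linear polynomials -/

section Exponential

variable {ρ : CInf Fq}

/-- The coefficient of `z ^ (q ^ i)` in the exponential function of the lattice `A`. -/
noncomputable def expCoeff (ρ : CInf Fq) (i : ℕ) : CInf Fq :=
  carlitzPeriod ρ ^ (qCard Fq ^ i - 1) / dElem Fq i

/-- The exponential function of the lattice `A`. -/
noncomputable def expA (ρ : CInf Fq) (z : CInf Fq) : CInf Fq :=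
  ∑' i, expCoeff ρ i * z ^ qCard Fq ^ i

lemma expCoeff_zero : expCoeff ρ 0 = 1 := by simp [expCoeff, dElem_zero]

lemma qCard_pow_succ_sub_one (i : ℕ) :
    qCard Fq ^ (i + 1) - 1 = (qCard Fq - 1) + (qCard Fq ^ i - 1) * qCard Fq := by
  have h1 : 1 ≤ qCard Fq ^ i := Nat.one_le_pow _ _ qCard_pos
  have h2 := qCard_pos (Fq := Fq)
  have h3 : qCard Fq ≤ qCard Fq ^ i * qCard Fq := Nat.le_mul_of_pos_left _ h1
  rw [Nat.sub_mul, pow_succ]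
  omega

lemma expCoeff_succ (i : ℕ) : expCoeff ρ (i + 1) =
    carlitzPeriod ρ ^ (qCard Fq - 1) * expCoeff ρ i ^ qCard Fq / bracket Fq (i + 1) := by
  rw [expCoeff, expCoeff, qCard_pow_succ_sub_one, dElem_succ, pow_add, pow_mul, div_pow]
  field_simp

lemma linCoeff_succ_eq (d i : ℕ) : linCoeff Fq (d + 1) (i + 1) =
    recFactor Fq d * linCoeff Fq d i ^ qCard Fq / bracket Fq (i + 1) := by
  rw [recFactor, ← bracket_mul_linCoeff_succ, mul_div_cancel_left₀ _ (bracket_succ_ne_zero i)]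

lemma tendsto_linCoeff (hρ : ρ ^ (qCard Fq - 1) = -theta Fq) (i : ℕ) :
    Tendsto (fun d => linCoeff Fq d i) atTop (𝓝 (expCoeff ρ i)) := by
  induction i with
  | zero => simp only [linCoeff_zero_right, expCoeff_zero]; exact tendsto_const_nhds
  | succ i ih =>
    rw [← tendsto_add_atTop_iff_nat 1, expCoeff_succ]
    simp only [linCoeff_succ_eq]
    exact ((tendsto_recFactor hρ).mul (ih.pow _)).div_const _

/-- The two recursions, for `linCoeff` and for `expCoeff`, have factors of the same norm. The bound
is the domination needed to pass to the limit term by term in `tendsto_eval_linPoly`. -/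
lemma norm_linCoeff_le (hρ : ρ ^ (qCard Fq - 1) = -theta Fq) (d i : ℕ) :
    ‖linCoeff Fq d i‖ ≤ ‖expCoeff ρ i‖ := by
  induction i generalizing d with
  | zero => simp [linCoeff_zero_right, expCoeff_zero]
  | succ i ih =>
    rcases d with _ | d
    · simp [linCoeff]
    rw [linCoeff_succ_eq, expCoeff_succ, norm_div, norm_div, norm_mul, norm_mul, norm_recFactor,
      norm_pow, norm_pow, norm_pow, norm_carlitzPeriod_pow hρ]
    gcongr
    exact ih d

lemma norm_expCoeff_mul (hρ : ρ ^ (qCard Fq - 1) = -theta Fq) (i : ℕ) :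
    ‖expCoeff ρ i‖ * ‖carlitzPeriod ρ‖ =
      (‖carlitzPeriod ρ‖ / (qCard Fq : ℝ) ^ i) ^ qCard Fq ^ i := by
  have h := norm_carlitzPeriod_pos hρ
  rw [expCoeff, norm_div, norm_dElem, norm_pow, div_mul_eq_mul_div, ← pow_succ,
    Nat.sub_add_cancel (Nat.one_le_pow _ _ qCard_pos), div_pow, ← pow_mul]

lemma summable_norm_expCoeff (hρ : ρ ^ (qCard Fq - 1) = -theta Fq) (B : ℝ) (hB : 0 ≤ B) :
    Summable fun i => ‖expCoeff ρ i‖ * B ^ qCard Fq ^ i := by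
  have hπ := norm_carlitzPeriod_pos hρ
  have hq := one_lt_qCard Fq
  rw [← summable_mul_right_iff hπ.ne']
  have hlim : Tendsto (fun i : ℕ => ‖carlitzPeriod ρ‖ * B * (qCard Fq : ℝ)⁻¹ ^ i) atTop (𝓝 0) := by
    simpa using (tendsto_pow_atTop_nhds_zero_of_lt_one (by positivity)
      (inv_lt_one_of_one_lt₀ hq)).const_mul (‖carlitzPeriod ρ‖ * B)
  refine Summable.of_norm_bounded_eventually_nat
    (summable_geometric_of_lt_one (by norm_num) (by norm_num : (1 / 2 : ℝ) < 1)) ?_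
  filter_upwards [hlim.eventually (gt_mem_nhds (by norm_num : (0 : ℝ) < 1 / 2))] with i hi
  have h1 : ‖expCoeff ρ i‖ * B ^ qCard Fq ^ i * ‖carlitzPeriod ρ‖ =
      (‖carlitzPeriod ρ‖ * B * (qCard Fq : ℝ)⁻¹ ^ i) ^ qCard Fq ^ i := by
    rw [mul_right_comm, norm_expCoeff_mul hρ, ← mul_pow, inv_pow]
    congr 1
    ring
  rw [h1, Real.norm_of_nonneg (by positivity)]
  calc _ ≤ (1 / 2 : ℝ) ^ qCard Fq ^ i := by gcongr
    _ ≤ _ := pow_le_pow_of_le_one (by norm_num) (by norm_num)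
      (Nat.lt_pow_self one_lt_qCard_nat).le

lemma hasSum_expA (hρ : ρ ^ (qCard Fq - 1) = -theta Fq) (z : CInf Fq) :
    HasSum (fun i => expCoeff ρ i * z ^ qCard Fq ^ i) (expA ρ z) := by
  refine Summable.hasSum (Summable.of_norm ?_)
  simpa using summable_norm_expCoeff hρ ‖z‖ (norm_nonneg z)

lemma tendsto_eval_linPoly (hρ : ρ ^ (qCard Fq - 1) = -theta Fq) (z : CInf Fq) :
    Tendsto (fun d => (linPoly Fq d).eval z) atTop (𝓝 (expA ρ z)) := by
  have h : ∀ d, (linPoly Fq d).eval z = ∑' i, linCoeff Fq d i * z ^ qCard Fq ^ i := fun d => by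
    rw [eval_linPoly, tsum_eq_sum]
    intro i hi
    rw [linCoeff_eq_zero (by simpa using hi), zero_mul]
  simp only [h]
  refine tendsto_tsum_of_dominated_convergence (summable_norm_expCoeff hρ ‖z‖ (norm_nonneg z))
    (fun i => (tendsto_linCoeff hρ i).mul_const _) (Eventually.of_forall fun d i => ?_)
  rw [norm_mul, norm_pow]
  gcongr
  exact norm_linCoeff_le hρ d i

lemma carlitzExp_period_mul (z : CInf Fq) :
    carlitzExp (carlitzPeriod ρ * z) = carlitzPeriod ρ * expA ρ z := by
  rw [carlitzExp, expA, ← tsum_mul_left]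
  congr 1
  funext i
  rw [expCoeff, mul_pow, ← Nat.sub_add_cancel (Nat.one_le_pow i _ (qCard_pos (Fq := Fq))), pow_succ,
    Nat.add_sub_cancel, dElem]
  ring

end Exponential

/-! ### Logarithmic derivatives and infinite products over `A` -/

section LatticeSums

lemma zero_mem_polyLT (d : ℕ) : (0 : Fq[X]) ∈ polyLT Fq d := by simp [mem_polyLT]

/-- Logarithmic differentiation of the product form of `E_d`, using `E_d' = 1`. A general algebra
`R`, with `v a` playing the role of `(w - a)⁻¹`, allows `w` to be a power series as well as a
number. -/
lemma sum_inv_mul_aeval_linPoly {R : Type*} [CommRing R] [Algebra (CInf Fq) R] (d : ℕ) (w : R)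
    (v : Fq[X] → R) (hv : ∀ a ∈ polyLT Fq d, (w - algebraMap (CInf Fq) R (ofA Fq a)) * v a = 1) :
    (∑ a ∈ polyLT Fq d, v a) * Polynomial.aeval w (linPoly Fq d) = 1 := by
  classical
  obtain ⟨κ, hκ⟩ := exists_linPoly_eq (Fq := Fq) d
  have h1 := congrArg (Polynomial.aeval w) (derivative_linPoly (Fq := Fq) d)
  rw [hκ, Polynomial.derivative_C_mul, Polynomial.derivative_prod_finset] at h1
  simp only [map_mul, map_sum, map_prod, map_sub, Polynomial.aeval_C, Polynomial.aeval_X,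
    Polynomial.derivative_X, Polynomial.derivative_C, map_one, sub_zero, mul_one] at h1
  rw [hκ, map_mul, Polynomial.aeval_C, ← h1, mul_left_comm, Finset.sum_mul]
  congr 1
  refine Finset.sum_congr rfl fun a ha => ?_
  rw [map_prod, ← Finset.mul_prod_erase _ _ ha]
  simp only [map_sub, Polynomial.aeval_C, Polynomial.aeval_X]
  rw [← mul_assoc, mul_comm (v a), hv a ha, one_mul]

/-- The constant `κ` is fixed by `E_d'(0) = 1`, because only the summand omitting the factor at `a =
0` survives at `0`. On the right the index `a = 0` contributes the factor `1`, since `z / 0 = 0`. -/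
lemma eval_linPoly_eq_prod (d : ℕ) (z : CInf Fq) :
    (linPoly Fq d).eval z = z * ∏ a ∈ polyLT Fq d, (1 - z / ofA Fq a) := by
  classical
  obtain ⟨κ, hκ⟩ := exists_linPoly_eq (Fq := Fq) d
  have h1 := congrArg (Polynomial.eval 0) (derivative_linPoly (Fq := Fq) d)
  rw [hκ, Polynomial.derivative_C_mul, Polynomial.derivative_prod_finset, Polynomial.eval_mul,
    Polynomial.eval_finsetSum, Finset.sum_eq_single_of_mem 0 (zero_mem_polyLT d)] at h1
  · simp only [Polynomial.eval_C, Polynomial.eval_prod, Polynomial.eval_sub,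
      Polynomial.eval_X, Polynomial.derivative_sub, Polynomial.derivative_X,
      Polynomial.derivative_C, sub_zero, Polynomial.eval_one, mul_one, zero_sub] at h1
    rw [hκ, Polynomial.eval_mul, Polynomial.eval_C, Polynomial.eval_prod,
      ← Finset.mul_prod_erase _ _ (zero_mem_polyLT d),
      ← Finset.mul_prod_erase _ _ (zero_mem_polyLT d)]
    have h2 : ∀ a ∈ (polyLT Fq d).erase 0,
        (Polynomial.X - Polynomial.C (ofA Fq a)).eval z = -ofA Fq a * (1 - z / ofA Fq a) := by
      intro a ha
      have : ofA Fq a ≠ 0 := (map_ne_zero_iff _ ofA_injective).2 (Finset.ne_of_mem_erase ha)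
      simp only [Polynomial.eval_sub, Polynomial.eval_X, Polynomial.eval_C]
      field_simp
      ring
    rw [Finset.prod_congr rfl h2, Finset.prod_mul_distrib]
    simp only [map_zero, sub_zero, Polynomial.eval_X, div_zero, one_mul]
    linear_combination (z * ∏ a ∈ (polyLT Fq d).erase 0, (1 - z / ofA Fq a)) * h1
  · intro a _ ha
    rw [Polynomial.eval_mul, Polynomial.eval_prod,
      Finset.prod_eq_zero (Finset.mem_erase.2 ⟨ha.symm, zero_mem_polyLT d⟩) (by simp), zero_mul]

lemma tendsto_inv_ofA_cofinite : Tendsto (fun a : Fq[X] => (ofA Fq a)⁻¹) cofinite (𝓝 0) := by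
  rw [tendsto_zero_iff_norm_tendsto_zero]
  simp only [norm_inv]
  exact tendsto_norm_ofA_cofinite.inv_tendsto_atTop

variable {ρ : CInf Fq}

lemma hasProd_expA (hρ : ρ ^ (qCard Fq - 1) = -theta Fq) {z : CInf Fq} (hz : z ≠ 0) :
    HasProd (fun a : Fq[X] => 1 - z / ofA Fq a) (expA ρ z / z) := by
  have h1 : Tendsto (fun a : Fq[X] => -(z / ofA Fq a)) cofinite (𝓝 0) := by
    simpa [div_eq_mul_inv] using (tendsto_inv_ofA_cofinite (Fq := Fq)).const_mul (-z)
  have h2 := multipliable_one_add_of_tendsto_cofinite h1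
  simp only [← sub_eq_add_neg] at h2
  obtain ⟨P, hP⟩ := h2
  have h3 : Tendsto (fun d => z * ∏ a ∈ polyLT Fq d, (1 - z / ofA Fq a)) atTop (𝓝 (z * P)) :=
    (Tendsto.comp hP tendsto_polyLT).const_mul z
  simp only [← eval_linPoly_eq_prod] at h3
  rw [tendsto_nhds_unique (tendsto_eval_linPoly hρ z) h3, mul_div_cancel_left₀ _ hz]
  exact hP

lemma mul_period_mem_carlitzLattice_iff (hρ : ρ ^ (qCard Fq - 1) = -theta Fq) {z : CInf Fq} :
    carlitzPeriod ρ * z ∈ carlitzLattice ρ ↔ z ∈ Set.range (ofA Fq) := by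
  constructor
  · rintro ⟨a, ha⟩
    refine ⟨a, mul_right_cancel₀ (carlitzPeriod_ne_zero hρ) (ha.trans (mul_comm _ _))⟩
  · rintro ⟨a, rfl⟩
    exact ⟨a, mul_comm _ _⟩

lemma latticeExp_carlitzLattice (hρ : ρ ^ (qCard Fq - 1) = -theta Fq) (z : CInf Fq) :
    latticeExp (carlitzLattice ρ) (carlitzPeriod ρ * z) = carlitzPeriod ρ * expA ρ z := by
  have hπ := carlitzPeriod_ne_zero hρ
  rcases eq_or_ne z 0 with rfl | hz
  · have : expA ρ (0 : CInf Fq) = 0 := by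
      rw [expA]
      simp
    simp [latticeExp, this]
  let g : {l : CInf Fq // l ∈ carlitzLattice ρ ∧ l ≠ 0} → Fq[X] := fun l => l.2.1.choose
  have hg : ∀ l, ofA Fq (g l) * carlitzPeriod ρ = (l : CInf Fq) := fun l => l.2.1.choose_spec
  have hinj : Function.Injective g := fun l l' h => Subtype.ext (by rw [← hg, h, hg])
  have h1 := (hinj.hasProd_iff (f := fun a : Fq[X] => 1 - z / ofA Fq a) (a := expA ρ z / z)
    fun a ha => ?_).2 (hasProd_expA hρ hz)
  · have h2 : (fun l : {l : CInf Fq // l ∈ carlitzLattice ρ ∧ l ≠ 0} =>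
        1 - carlitzPeriod ρ * z / (l : CInf Fq)) = (fun a : Fq[X] => 1 - z / ofA Fq a) ∘ g := by
      funext l
      rw [Function.comp_apply, ← hg l, mul_comm (ofA Fq (g l)), mul_div_mul_left _ _ hπ]
    rw [latticeExp, h2, h1.tprod_eq]
    field_simp
  -- The only polynomial not indexing a nonzero lattice point is `0`, whose factor is `1` by the
  -- convention `z / 0 = 0`.
  · rcases eq_or_ne a 0 with rfl | h0
    · simp
    · exfalso
      refine ha ⟨⟨ofA Fq a * carlitzPeriod ρ, ⟨a, rfl⟩,
        mul_ne_zero ((map_ne_zero_iff _ ofA_injective).2 h0) hπ⟩, ?_⟩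
      exact ofA_injective (mul_right_cancel₀ hπ (hg _))

lemma summable_inv_pow_sub_ofA (z : CInf Fq) (r : ℕ) :
    Summable fun a : Fq[X] => ((z - ofA Fq a)⁻¹) ^ (r + 1) := by
  refine NonarchimedeanAddGroup.summable_of_tendsto_cofinite_zero ?_
  have h : Tendsto (fun a : Fq[X] => (z - ofA Fq a)⁻¹) cofinite (𝓝 0) := by
    rw [tendsto_zero_iff_norm_tendsto_zero]
    simp only [norm_inv]
    refine Tendsto.inv_tendsto_atTop ?_
    refine tendsto_atTop_mono (fun a => ?_)
      (tendsto_atTop_add_const_right _ (-‖z‖) (tendsto_norm_ofA_cofinite (Fq := Fq)))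
    have := norm_sub_norm_le (ofA Fq a) z
    rw [norm_sub_rev] at this
    linarith
  simpa using h.pow (r + 1)

end LatticeSums

end

/-! ## Goss polynomials of the Carlitz lattice -/

section

variable {Fq : Type*} [Field Fq] [Fintype Fq]

section QSeries

/-- The power series `∑ c_i X ^ (q ^ i)`. -/
noncomputable def qSeries (c : ℕ → CInf Fq) : (CInf Fq)⟦X⟧ :=
  PowerSeries.mk fun m => ∑ i ∈ Finset.range (m + 1), if qCard Fq ^ i = m then c i else 0

lemma coeff_qSeries (c : ℕ → CInf Fq) (m : ℕ) : PowerSeries.coeff m (qSeries c) =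
    ∑ i ∈ Finset.range (m + 1), if qCard Fq ^ i = m then c i else 0 := by
  rw [qSeries, PowerSeries.coeff_mk]

lemma coeff_qSeries_pow (c : ℕ → CInf Fq) (i : ℕ) :
    PowerSeries.coeff (qCard Fq ^ i) (qSeries c) = c i := by
  rw [coeff_qSeries, Finset.sum_eq_single_of_mem i]
  · simp
  · rw [Finset.mem_range]
    exact (Nat.lt_pow_self one_lt_qCard_nat).trans (Nat.lt_succ_self _)
  · intro k _ hk
    rw [if_neg]
    exact fun h => hk (Nat.pow_right_injective one_lt_qCard_nat h)

lemma coeff_qSeries_eq_zero (c : ℕ → CInf Fq) {m : ℕ} (hm : ∀ i, qCard Fq ^ i ≠ m) :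
    PowerSeries.coeff m (qSeries c) = 0 := by
  rw [coeff_qSeries]
  exact Finset.sum_eq_zero fun i _ => if_neg (hm i)

lemma constantCoeff_qSeries (c : ℕ → CInf Fq) : PowerSeries.constantCoeff (qSeries c) = 0 := by
  rw [← PowerSeries.coeff_zero_eq_constantCoeff_apply]
  exact coeff_qSeries_eq_zero c fun i => (pow_pos qCard_pos i).ne'

lemma coeff_qSeries_pow_eq_zero (c : ℕ → CInf Fq) {r j : ℕ} (h : r < j) :
    PowerSeries.coeff r (qSeries c ^ j) = 0 := by
  obtain ⟨g, hg⟩ := PowerSeries.X_dvd_iff.2 (constantCoeff_qSeries c)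
  rw [hg, mul_pow, PowerSeries.coeff_X_pow_mul', if_neg (by omega)]

lemma coe_linPoly (d : ℕ) : (linPoly Fq d : (CInf Fq)⟦X⟧) = qSeries (linCoeff Fq d) := by
  have h : linPoly Fq d = ∑ i ∈ Finset.range (d + 1),
      Polynomial.C (linCoeff Fq d i) * Polynomial.X ^ qCard Fq ^ i := by
    refine Polynomial.funext fun z => ?_
    rw [eval_linPoly]
    simp [Polynomial.eval_finsetSum]
  ext m
  rw [Polynomial.coeff_coe, h, Polynomial.finsetSum_coeff]
  simp only [Polynomial.coeff_C_mul, Polynomial.coeff_X_pow, mul_ite, mul_one, mul_zero]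
  by_cases hm : ∃ i, qCard Fq ^ i = m
  · obtain ⟨i, rfl⟩ := hm
    rw [coeff_qSeries_pow]
    rw [Finset.sum_eq_single i]
    · simp
    · intro k _ hk
      rw [if_neg]
      exact fun h => hk (Nat.pow_right_injective one_lt_qCard_nat h.symm)
    · intro hi
      rw [if_pos rfl, linCoeff_eq_zero (by simpa using hi)]
  · rw [coeff_qSeries_eq_zero _ (not_exists.1 hm)]
    exact Finset.sum_eq_zero fun i _ => if_neg fun h => not_exists.1 hm i h.symm

lemma tendsto_coeff_pow {E : ℕ → (CInf Fq)⟦X⟧} {F : (CInf Fq)⟦X⟧}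
    (h : ∀ m, Tendsto (fun d => PowerSeries.coeff m (E d)) atTop (𝓝 (PowerSeries.coeff m F)))
    (j m : ℕ) :
    Tendsto (fun d => PowerSeries.coeff m (E d ^ j)) atTop (𝓝 (PowerSeries.coeff m (F ^ j))) := by
  induction j generalizing m with
  | zero => simp only [pow_zero]; exact tendsto_const_nhds
  | succ j ih =>
    simp only [pow_succ, PowerSeries.coeff_mul]
    exact tendsto_finsetSum _ fun ab _ => (ih ab.1).mul (h ab.2)

/-- Coefficients of a power series `V` with `V (A - E) = 1`. -/
lemma coeff_eq_sum_of_mul_sub_eq_one {F : Type*} [Field F] {A : F} (hA : A ≠ 0) {E V : F⟦X⟧}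
    (hE : PowerSeries.constantCoeff E = 0) (h : V * (PowerSeries.C A - E) = 1) (r : ℕ) :
    PowerSeries.coeff r V =
      ∑ j ∈ Finset.range (r + 1), A⁻¹ ^ (j + 1) * PowerSeries.coeff r (E ^ j) := by
  set t := PowerSeries.C A⁻¹ with ht
  have htA : t * PowerSeries.C A = 1 := by rw [ht, ← map_mul, inv_mul_cancel₀ hA, map_one]
  have h1 : V * (1 - t * E) = t := by
    linear_combination t * h - V * htA
  -- A truncated geometric series; the remainder is divisible by `X ^ (r + 1)` and does not affect
  -- the coefficient at `r`.
  have h2 : V = t * ∑ j ∈ Finset.range (r + 1), (t * E) ^ j + V * (t * E) ^ (r + 1) := by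
    have h3 := mul_neg_geom_sum (t * E) (r + 1)
    linear_combination (∑ j ∈ Finset.range (r + 1), (t * E) ^ j) * h1 - V * h3
  have h4 : PowerSeries.coeff r (V * (t * E) ^ (r + 1)) = 0 := by
    obtain ⟨g, rfl⟩ := PowerSeries.X_dvd_iff.2 hE
    rw [show V * (t * (PowerSeries.X * g)) ^ (r + 1) =
      PowerSeries.X ^ (r + 1) * (V * (t * g) ^ (r + 1)) by ring, PowerSeries.coeff_X_pow_mul',
      if_neg (by omega)]
  have h5 : PowerSeries.coeff r V =
      PowerSeries.coeff r (t * ∑ j ∈ Finset.range (r + 1), (t * E) ^ j) := by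
    conv_lhs => rw [h2, map_add, h4, add_zero]
  rw [h5, Finset.mul_sum, map_sum]
  refine Finset.sum_congr rfl fun j _ => ?_
  rw [mul_pow, ← mul_assoc, ← pow_succ', ht, ← map_pow, PowerSeries.coeff_C_mul]

end QSeries

section Goss

variable {ρ : CInf Fq}

/-- The power series of the exponential function of the lattice `A`. -/
noncomputable def expSeries (ρ : CInf Fq) : (CInf Fq)⟦X⟧ := qSeries (expCoeff ρ)

/-- The generating series in `X` of the sums on the left is `∑ 1 / (z - X - a)`. By the logarithmic
derivative at `z - X` and additivity it equals `1 / (E_d(z) - E_d(X))`, which is expanded as a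
geometric series. -/
lemma sum_inv_pow_sub_ofA (d r : ℕ) {z : CInf Fq} (hz : z ∉ Set.range (ofA Fq)) :
    ∑ a ∈ polyLT Fq d, ((z - ofA Fq a)⁻¹) ^ (r + 1) =
      ∑ j ∈ Finset.range (r + 1), ((linPoly Fq d).eval z)⁻¹ ^ (j + 1) *
        PowerSeries.coeff r (qSeries (linCoeff Fq d) ^ j) := by
  have hz' : ∀ a, z - ofA Fq a ≠ 0 := fun a h => hz ⟨a, (sub_eq_zero.1 h).symm⟩
  have hne : (linPoly Fq d).eval z ≠ 0 := by
    have := sum_inv_mul_aeval_linPoly (R := CInf Fq) d z (fun a => (z - ofA Fq a)⁻¹)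
      fun a _ => mul_inv_cancel₀ (hz' a)
    rw [Polynomial.coe_aeval_eq_eval] at this
    exact right_ne_zero_of_mul_eq_one this
  have : CharP (CInf Fq)⟦X⟧ (ringChar Fq) :=
    charP_of_injective_ringHom (f := PowerSeries.C (R := CInf Fq)) PowerSeries.C_injective _
  have h1 := sum_inv_mul_aeval_linPoly (R := (CInf Fq)⟦X⟧) d (PowerSeries.C z - PowerSeries.X)
    (fun a => PowerSeries.invUnitsSub (Units.mk0 _ (hz' a))) fun a _ => by
      rw [mul_comm, ← PowerSeries.invUnitsSub_mul_sub (Units.mk0 _ (hz' a))]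
      congr 1
      rw [Units.val_mk0, map_sub]
      change _ - PowerSeries.C (ofA Fq a) = _
      ring
  rw [aeval_linPoly_sub] at h1
  have h2 : Polynomial.aeval (PowerSeries.C z) (linPoly Fq d) =
      PowerSeries.C ((linPoly Fq d).eval z) := by
    have := Polynomial.aeval_algebraMap_apply_eq_algebraMap_eval (A := (CInf Fq)⟦X⟧) z (linPoly Fq d)
    exact this
  have h3 : Polynomial.aeval (PowerSeries.X : (CInf Fq)⟦X⟧) (linPoly Fq d) =
      qSeries (linCoeff Fq d) := by
    rw [← coe_linPoly]
    have := Polynomial.aeval_algHom_apply (Polynomial.coeToPowerSeries.algHom (R := CInf Fq) (CInf Fq))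
      Polynomial.X (linPoly Fq d)
    simpa [Polynomial.coeToPowerSeries.algHom_apply] using this
  rw [h2, h3] at h1
  rw [← coeff_eq_sum_of_mul_sub_eq_one hne (constantCoeff_qSeries _) h1, map_sum]
  refine Finset.sum_congr rfl fun a _ => ?_
  rw [PowerSeries.coeff_invUnitsSub, one_divp, ← inv_pow]
  simp

lemma hasSum_inv_sub_ofA (hρ : ρ ^ (qCard Fq - 1) = -theta Fq) {z : CInf Fq}
    (hz : z ∉ Set.range (ofA Fq)) :
    expA ρ z ≠ 0 ∧ HasSum (fun a : Fq[X] => (z - ofA Fq a)⁻¹) (expA ρ z)⁻¹ := by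
  have hz' : ∀ a, z - ofA Fq a ≠ 0 := fun a h => hz ⟨a, (sub_eq_zero.1 h).symm⟩
  obtain ⟨S, hS⟩ := summable_inv_pow_sub_ofA z 0
  simp only [zero_add, pow_one] at hS
  have h1 := (Tendsto.comp hS tendsto_polyLT).mul (tendsto_eval_linPoly hρ z)
  have h2 : S * expA ρ z = 1 := by
    refine tendsto_nhds_unique h1 ?_
    refine tendsto_const_nhds.congr fun d => ?_
    have := sum_inv_mul_aeval_linPoly (R := CInf Fq) d z (fun a => (z - ofA Fq a)⁻¹)
      fun a _ => mul_inv_cancel₀ (hz' a)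
    rw [Polynomial.coe_aeval_eq_eval] at this
    exact this.symm
  refine ⟨right_ne_zero_of_mul_eq_one h2, ?_⟩
  rwa [← eq_inv_of_mul_eq_one_left h2]

/-- The series over `A` converges unconditionally, so its sum can be computed along the sets of
polynomials of degree less than `d`, where the finite formula passes to the limit. -/
lemma hasSum_inv_pow_sub_ofA (hρ : ρ ^ (qCard Fq - 1) = -theta Fq) {z : CInf Fq}
    (hz : z ∉ Set.range (ofA Fq)) (r : ℕ) :
    HasSum (fun a : Fq[X] => ((z - ofA Fq a)⁻¹) ^ (r + 1))
      (∑ j ∈ Finset.range (r + 1), (expA ρ z)⁻¹ ^ (j + 1) *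
        PowerSeries.coeff r (expSeries ρ ^ j)) := by
  obtain ⟨S, hS⟩ := summable_inv_pow_sub_ofA z r
  have h1 := Tendsto.comp hS tendsto_polyLT
  have h2 : Tendsto (fun d => ∑ a ∈ polyLT Fq d, ((z - ofA Fq a)⁻¹) ^ (r + 1)) atTop
      (𝓝 (∑ j ∈ Finset.range (r + 1), (expA ρ z)⁻¹ ^ (j + 1) *
        PowerSeries.coeff r (expSeries ρ ^ j))) := by
    simp only [sum_inv_pow_sub_ofA _ r hz]
    refine tendsto_finsetSum _ fun j _ => ?_
    refine (((tendsto_eval_linPoly hρ z).inv₀ (hasSum_inv_sub_ofA hρ hz).1).pow _).mul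
      (tendsto_coeff_pow (fun m => ?_) j r)
    simp only [expSeries, coeff_qSeries]
    refine tendsto_finsetSum _ fun i _ => ?_
    split_ifs
    · exact tendsto_linCoeff hρ i
    · exact tendsto_const_nhds
  rwa [← tendsto_nhds_unique h1 h2]

/-- The coefficients `β_{r,j}`, expressed through the exponential series. -/
noncomputable def expPowCoeff (ρ : CInf Fq) (r j : ℕ) : CInf Fq :=
  carlitzPeriod ρ ^ j / carlitzPeriod ρ ^ r * PowerSeries.coeff r (expSeries ρ ^ j)

/-- The Goss polynomials of the Carlitz lattice. -/
noncomputable def carlitzGoss (ρ : CInf Fq) (r : ℕ) : (CInf Fq)[X] :=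
  ∑ j ∈ Finset.range (r + 1), Polynomial.C (expPowCoeff ρ r j) * Polynomial.X ^ (j + 1)

lemma isGossPoly_carlitzGoss (hρ : ρ ^ (qCard Fq - 1) = -theta Fq) (r : ℕ) :
    IsGossPoly (carlitzLattice ρ) (r + 1) (carlitzGoss ρ r) := by
  intro w hw
  have hπ := carlitzPeriod_ne_zero hρ
  obtain ⟨z, rfl⟩ : ∃ z, carlitzPeriod ρ * z = w := ⟨w / carlitzPeriod ρ, by field_simp⟩
  rw [mul_period_mem_carlitzLattice_iff hρ] at hw
  have h1 := (hasSum_inv_pow_sub_ofA hρ hw r).mul_left ((carlitzPeriod ρ)⁻¹ ^ (r + 1))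
  have hinj : Function.Injective fun a : Fq[X] => ofA Fq a * carlitzPeriod ρ := fun a b h =>
    ofA_injective (mul_right_cancel₀ hπ h)
  refine (Equiv.ofInjective _ hinj).hasSum_iff.1 ?_
  convert! h1 using 1
  · funext a
    change 1 / (carlitzPeriod ρ * z - ofA Fq a * carlitzPeriod ρ) ^ (r + 1) = _
    rw [one_div, ← inv_pow, ← mul_pow, ← mul_inv]
    congr 2
    ring
  · have hz0 := (hasSum_inv_sub_ofA hρ hw).1
    rw [latticeT, latticeExp_carlitzLattice hρ, carlitzGoss, Polynomial.eval_finsetSum,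
      Finset.mul_sum]
    refine Finset.sum_congr rfl fun j _ => ?_
    rw [Polynomial.eval_mul, Polynomial.eval_C, Polynomial.eval_pow, Polynomial.eval_X, expPowCoeff,
      one_div, mul_inv, mul_pow]
    have h2 : carlitzPeriod ρ ^ j / carlitzPeriod ρ ^ r * (carlitzPeriod ρ)⁻¹ ^ (j + 1) =
        (carlitzPeriod ρ)⁻¹ ^ (r + 1) := by
      rw [inv_pow, inv_pow]
      field_simp
      ring
    rw [← h2]
    ring

lemma uParam_eq (z : Omega Fq) :
    uParam ρ z = (carlitzPeriod ρ)⁻¹ * (expA ρ (z : CInf Fq))⁻¹ := by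
  rw [uParam, carlitzExp_period_mul, one_div, mul_inv]

lemma not_mem_range_ofA (z : Omega Fq) : (z : CInf Fq) ∉ Set.range (ofA Fq) := by
  rintro ⟨a, ha⟩
  exact z.2 ⟨polyToKInf Fq a, ha⟩

lemma uParam_ne_zero (hρ : ρ ^ (qCard Fq - 1) = -theta Fq) (z : Omega Fq) : uParam ρ z ≠ 0 := by
  rw [uParam_eq]
  exact mul_ne_zero (inv_ne_zero (carlitzPeriod_ne_zero hρ))
    (inv_ne_zero (hasSum_inv_sub_ofA hρ (not_mem_range_ofA z)).1)

/-- Up to the factor `π̃⁻¹`, `u(z)` is the sum of the `(z - a)⁻¹`, and each term has norm at most `1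
/ |z|_i`. -/
lemma norm_uParam_le (hρ : ρ ^ (qCard Fq - 1) = -theta Fq) (z : Omega Fq) :
    ‖uParam ρ z‖ ≤ ‖carlitzPeriod ρ‖⁻¹ * (imagPart (z : CInf Fq))⁻¹ := by
  have h := imagPart_pos z.2
  rw [uParam_eq, norm_mul, norm_inv]
  refine mul_le_mul_of_nonneg_left ?_ (inv_nonneg.2 (norm_nonneg _))
  refine norm_le_of_hasSum (hasSum_inv_sub_ofA hρ (not_mem_range_ofA z)).2 (inv_nonneg.2 h.le)
    fun a => ?_
  rw [norm_inv]
  exact inv_anti₀ h (imagPart_le_norm_sub_ofA _ a)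

/-- The parameter `u` takes arbitrarily small values far up in `Ω`. -/
lemma exists_norm_uParam_lt (hρ : ρ ^ (qCard Fq - 1) = -theta Fq) (R : ℝ) {ε : ℝ} (hε : 0 < ε) :
    ∃ z : Omega Fq, R < imagPart (z : CInf Fq) ∧ ‖uParam ρ z‖ < ε := by
  have hπ := norm_carlitzPeriod_pos hρ
  obtain ⟨z, hz⟩ := exists_lt_imagPart (Fq := Fq) (max R (‖carlitzPeriod ρ‖⁻¹ * ε⁻¹))
  refine ⟨z, (le_max_left _ _).trans_lt hz, (norm_uParam_le hρ z).trans_lt ?_⟩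
  have h1 := (le_max_right _ _).trans_lt hz
  have h2 := imagPart_pos z.2
  rw [← div_eq_mul_inv, div_lt_iff₀ h2]
  rw [← div_eq_mul_inv, div_lt_iff₀ hε] at h1
  linarith

/-- Two Goss polynomials agree at every value of `u` on `Ω`. These values are nonzero and accumulate
at `0`, so the polynomials coincide and the arbitrary choice in the definition is harmless. -/
lemma gossPoly_carlitzLattice (hρ : ρ ^ (qCard Fq - 1) = -theta Fq) (r : ℕ) :
    gossPoly (carlitzLattice ρ) (r + 1) = carlitzGoss ρ r := by
  have hex : ∃ G, IsGossPoly (carlitzLattice ρ) (r + 1) G := ⟨_, isGossPoly_carlitzGoss hρ r⟩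
  rw [gossPoly, dif_pos hex]
  have hG := hex.choose_spec
  set G := hex.choose
  rw [← sub_eq_zero]
  refine Polynomial.ext fun n => ?_
  rw [Polynomial.coeff_zero]
  refine powerSeries_coeff_eq_zero (a := fun n => (G - carlitzGoss ρ r).coeff n)
    (fun ε hε => ?_) n
  obtain ⟨z, -, hz⟩ := exists_norm_uParam_lt hρ 0 hε
  refine ⟨uParam ρ z, uParam_ne_zero hρ z, hz, ?_⟩
  have hmem : carlitzPeriod ρ * (z : CInf Fq) ∉ carlitzLattice ρ := by
    rw [mul_period_mem_carlitzLattice_iff hρ]; exact not_mem_range_ofA z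
  have ht : latticeT (carlitzLattice ρ) (carlitzPeriod ρ * (z : CInf Fq)) = uParam ρ z := by
    rw [latticeT, latticeExp_carlitzLattice hρ, uParam, carlitzExp_period_mul]
  have h0 : (G - carlitzGoss ρ r).eval (uParam ρ z) = 0 := by
    rw [Polynomial.eval_sub, sub_eq_zero, ← ht]
    exact (hG _ hmem).unique (isGossPoly_carlitzGoss hρ r _ hmem)
  rw [← h0, Polynomial.eval_eq_sum_range]
  refine hasSum_sum_of_ne_finset_zero fun j hj => ?_
  rw [Polynomial.coeff_eq_zero_of_natDegree_lt (by simpa using hj), zero_mul]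

lemma coeff_carlitzGoss (r j : ℕ) : (carlitzGoss ρ r).coeff (j + 1) = expPowCoeff ρ r j := by
  rw [carlitzGoss, Polynomial.finsetSum_coeff]
  simp only [Polynomial.coeff_C_mul, Polynomial.coeff_X_pow, mul_ite, mul_one, mul_zero,
    Nat.add_right_cancel_iff]
  rw [Finset.sum_ite_eq]
  split_ifs with h
  · rfl
  · rw [expPowCoeff, expSeries, coeff_qSeries_pow_eq_zero _ (by simpa using h), mul_zero]

lemma gossCoeff_eq (hρ : ρ ^ (qCard Fq - 1) = -theta Fq) (r j : ℕ) :
    gossCoeff ρ r j = expPowCoeff ρ r j := by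
  rw [gossCoeff, gossPoly_carlitzLattice hρ, coeff_carlitzGoss]

end Goss

end

/-! ## Hyperderivatives of holomorphic functions -/

section

variable {Fq : Type*} [Field Fq] [Fintype Fq]

section Taylor

lemma HasTaylor.unique {f : Omega Fq → CInf Fq} {z : Omega Fq} {a a' : ℕ → CInf Fq}
    (h : HasTaylor f z a) (h' : HasTaylor f z a') : a = a' := by
  obtain ⟨ε₁, hε₁, h⟩ := h
  obtain ⟨ε₂, hε₂, h'⟩ := h'
  funext n
  rw [← sub_eq_zero]
  refine powerSeries_coeff_eq_zero (a := fun n => a n - a' n) (fun ε hε => ?_) n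
  obtain ⟨x, hx0, hx⟩ := NormedField.exists_norm_lt (CInf Fq)
    (lt_min hε (lt_min (lt_min hε₁ hε₂) (imagPart_pos z.2)))
  simp only [lt_min_iff] at hx
  obtain ⟨hx1, ⟨hx2, hx3⟩, hx4⟩ := hx
  refine ⟨x, norm_pos_iff.1 hx0, hx1, ?_⟩
  have h1 := (h ⟨_, norm_lt_imagPart_add_mem hx4⟩ (by simpa using hx2)).sub
    (h' ⟨_, norm_lt_imagPart_add_mem hx4⟩ (by simpa using hx3))
  simpa [sub_mul] using h1

lemma HasTaylor.hyperDeriv_eq {f : Omega Fq → CInf Fq} {z : Omega Fq} {a : ℕ → CInf Fq}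
    (h : HasTaylor f z a) (r : ℕ) : hyperDeriv r f z = a r := by
  have hex : ∃ a, HasTaylor f z a := ⟨a, h⟩
  rw [hyperDeriv, dif_pos hex, hex.choose_spec.unique h]

/-- The rational approximants of `f` expand in power series on discs of common radius `δ`. The
Cauchy estimate bounds differences of their coefficients uniformly in the centre, so the
coefficients converge uniformly on `Ω_n` to those of `f`. Each approximating coefficient is a
rational function of the centre. -/
lemma IsHolomorphic.exists_taylor {f : Omega Fq → CInf Fq} (hf : IsHolomorphic f) (n : ℕ) :
    ∃ A : ∀ z ∈ affinoid Fq n, ℕ → CInf Fq,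
      (∀ z : Omega Fq, ∀ hz : (z : CInf Fq) ∈ affinoid Fq n, HasTaylor f z (A z hz)) ∧
      ∀ (r : ℕ) (ε : ℝ), 0 < ε → ∃ P Q : (CInf Fq)[X], (∀ z ∈ affinoid Fq n, Q.eval z ≠ 0) ∧
        ∀ z, ∀ hz : z ∈ affinoid Fq n, ‖A z hz r - P.eval z / Q.eval z‖ ≤ ε := by
  have hq := one_lt_qCard Fq
  set δ : ℝ := ((qCard Fq : ℝ) ^ n)⁻¹ with hδ
  have hδ0 : 0 < δ := by positivity
  -- An element whose norm is just below `δ`: the Cauchy estimate is applied on the sphere through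
  -- `y₀`.
  set y₀ : CInf Fq := (theta Fq ^ (n + 1))⁻¹ with hy₀
  have hy₀n : ‖y₀‖ = ((qCard Fq : ℝ) ^ (n + 1))⁻¹ := by
    rw [hy₀, norm_inv, norm_pow, norm_theta]
  have hy₀δ : ‖y₀‖ < δ := by
    rw [hy₀n]
    exact inv_strictAnti₀ (by positivity) (pow_lt_pow_right₀ hq (Nat.lt_succ_self n))
  have hy₀0 : 0 < ‖y₀‖ := by rw [hy₀n]; positivity
  set ε : ℕ → ℝ := fun k => 1 / ((k : ℝ) + 1) with hε
  have hε0 : ∀ k, 0 < ε k := fun k => by positivity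
  have hεlim : Tendsto ε atTop (𝓝 0) := tendsto_one_div_add_atTop_nhds_zero_nat
  have hεanti : Antitone ε := fun k l h => by
    simp only [hε]
    gcongr
  choose P Q hQ hPQ using fun k => hf n (ε k) (hε0 k)
  have hdisc : ∀ k z, z ∈ affinoid Fq n →
      ∃ a, HasDiscSeries (fun w => (P k).eval w / (Q k).eval w) z δ a := fun k z hz =>
    exists_hasDiscSeries_div _ _ hδ0 fun x hx => hQ k _ (affinoid_add hz hx)
  choose a ha using hdisc
  have hcauchy : ∀ k l, k ≤ l → ∀ z (hz : z ∈ affinoid Fq n) j,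
      ‖(a k z hz j - a l z hz j) * y₀ ^ j‖ ≤ ε k := by
    intro k l hkl z hz j
    refine norm_coeff_mul_pow_le (ringChar Fq) (hε0 k).le
      (g := fun y => (P k).eval (z + y) / (Q k).eval (z + y) -
        (P l).eval (z + y) / (Q l).eval (z + y)) (a := fun j => a k z hz j - a l z hz j)
      (fun y hy => ?_) (fun y hy => ?_) j
    · simpa [sub_mul] using (ha k z hz y (hy ▸ hy₀δ)).sub (ha l z hz y (hy ▸ hy₀δ))
    · have hmem := affinoid_add hz (hy ▸ hy₀δ)
      have h1 := hPQ k ⟨z + y, affinoid_subset_Omega hmem⟩ hmem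
      have h2 := hPQ l ⟨z + y, affinoid_subset_Omega hmem⟩ hmem
      have h3 := norm_sub_le_max' (f ⟨z + y, affinoid_subset_Omega hmem⟩ -
          (P l).eval (z + y) / (Q l).eval (z + y))
        (f ⟨z + y, affinoid_subset_Omega hmem⟩ - (P k).eval (z + y) / (Q k).eval (z + y))
      rw [sub_sub_sub_cancel_left] at h3
      exact h3.trans (max_le (h2.trans (hεanti hkl)) h1)
  have hlim : ∀ z (hz : z ∈ affinoid Fq n) j, ∃ b, Tendsto (fun k => a k z hz j) atTop (𝓝 b) := by
    intro z hz j
    refine cauchySeq_tendsto_of_complete (cauchySeq_of_le_tendsto_0' (fun k => ε k / ‖y₀‖ ^ j)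
      (fun k l hkl => ?_) ?_)
    · rw [dist_eq_norm, le_div_iff₀ (by positivity), ← norm_pow, ← norm_mul]
      exact hcauchy k l hkl z hz j
    · simpa using hεlim.div_const (‖y₀‖ ^ j)
  choose A hA using hlim
  have hbound : ∀ k z (hz : z ∈ affinoid Fq n) j,
      ‖a k z hz j - A z hz j‖ * ‖y₀‖ ^ j ≤ ε k := by
    intro k z hz j
    have h1 := ((((hA z hz j).const_sub (a k z hz j)).mul_const (y₀ ^ j))).norm
    rw [norm_mul, norm_pow] at h1
    exact le_of_tendsto h1 (eventually_atTop.2 ⟨k, fun l hl => hcauchy k l hl z hz j⟩)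
  refine ⟨A, fun z hz => ⟨‖y₀‖, hy₀0, fun w hw => ?_⟩, fun r η hη => ?_⟩
  · set x : CInf Fq := (w : CInf Fq) - z with hx
    have hwx : (w : CInf Fq) = z + x := by rw [hx]; ring
    refine hasSum_of_uniform_limit (b := fun k j => a k z hz j * x ^ j) hεlim (fun k j => ?_)
      (fun k => ha k z hz x (hw.trans hy₀δ)) (fun k => ?_)
    · rw [← sub_mul, norm_mul, norm_pow]
      exact le_trans (by gcongr) (hbound k z hz j)
    · rw [norm_sub_rev]
      have hmem : (w : CInf Fq) ∈ affinoid Fq n := hwx ▸ affinoid_add hz (hw.trans hy₀δ)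
      have := hPQ k w hmem
      rwa [hwx] at this
  · obtain ⟨k, hk⟩ := ((hεlim.div_const (‖y₀‖ ^ r)).eventually
      (ge_mem_nhds (by simpa using hη))).exists
    obtain ⟨N, hN⟩ := exists_rational_hyperderivative (P k) (Q k) r
    refine ⟨N, Q k ^ (r + 1), fun z hz => ?_, fun z hz => ?_⟩
    · rw [Polynomial.eval_pow]
      exact pow_ne_zero _ (hQ k z hz)
    · rw [← hN z (a k z hz) (hQ k z hz), norm_sub_rev]
      · refine le_trans ?_ hk
        rw [le_div_iff₀ (by positivity)]
        exact hbound k z hz r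
      · intro m
        -- Multiplying the expansion of `P / Q` by that of `Q` must return that of `P`; uniqueness
        -- of coefficients gives the Leibniz relation.
        have h1 := ((hasDiscSeries_polynomial (Q k) z δ).mul (ha k z hz)).congr
          (g' := fun w => (P k).eval w) fun x hx =>
            mul_div_cancel₀ _ (hQ k _ (affinoid_add hz hx))
        exact congrFun (h1.unique hδ0 (hasDiscSeries_polynomial (P k) z δ)) m

lemma IsHolomorphic.exists_hasTaylor {f : Omega Fq → CInf Fq} (hf : IsHolomorphic f)
    (z : Omega Fq) : ∃ a, HasTaylor f z a := by
  obtain ⟨n, hn⟩ := exists_mem_affinoid z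
  obtain ⟨A, hA, -⟩ := hf.exists_taylor n
  exact ⟨_, hA z hn⟩

lemma IsHolomorphic.hyperDeriv {f : Omega Fq → CInf Fq} (hf : IsHolomorphic f) (r : ℕ) :
    IsHolomorphic (hyperDeriv r f) := by
  intro n ε hε
  obtain ⟨A, hA, h⟩ := hf.exists_taylor n
  obtain ⟨P, Q, hQ, hPQ⟩ := h r ε hε
  refine ⟨P, Q, hQ, fun z hz => ?_⟩
  rw [(hA z hz).hyperDeriv_eq]
  exact hPQ z hz

lemma IsHolomorphic.const_mul {f : Omega Fq → CInf Fq} (hf : IsHolomorphic f) (c : CInf Fq) :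
    IsHolomorphic fun z => c * f z := by
  intro n ε hε
  obtain ⟨P, Q, hQ, hPQ⟩ := hf n (ε / (‖c‖ + 1)) (by positivity)
  refine ⟨Polynomial.C c * P, Q, hQ, fun z hz => ?_⟩
  rw [Polynomial.eval_mul, Polynomial.eval_C, mul_div_assoc, ← mul_sub, norm_mul]
  calc _ ≤ (‖c‖ + 1) * (ε / (‖c‖ + 1)) := by
        refine mul_le_mul (by linarith) (hPQ z hz) (norm_nonneg _) (by positivity)
    _ = ε := by field_simp

lemma isHolomorphic_const (c : CInf Fq) : IsHolomorphic fun _ : Omega Fq => c := by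
  intro n ε hε
  exact ⟨Polynomial.C c, 1, fun z _ => by simp, fun z _ => by simpa using hε.le⟩

lemma IsHolomorphic.thetaOp {f : Omega Fq → CInf Fq} (hf : IsHolomorphic f) (ρ : CInf Fq) (r : ℕ) :
    IsHolomorphic (thetaOp ρ r f) := (hf.hyperDeriv r).const_mul _

lemma HasTaylor.translate {f : Omega Fq → CInf Fq} (hf : IsAPeriodic f) {a : Fq[X]}
    {z w : Omega Fq} (hw : (w : CInf Fq) = z + ofA Fq a) {b : ℕ → CInf Fq}
    (h : HasTaylor f z b) : HasTaylor f w b := by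
  obtain ⟨ε, hε, h⟩ := h
  refine ⟨ε, hε, fun v hv => ?_⟩
  have hmem : (v : CInf Fq) - ofA Fq a ∈ Omega Fq := by
    refine mem_Omega_of_imagPart_pos ?_
    rw [sub_eq_add_neg, ← map_neg, imagPart_add_ofA]
    exact imagPart_pos v.2
  have e : (v : CInf Fq) - ofA Fq a - z = v - w := by rw [hw]; ring
  have h1 := h ⟨_, hmem⟩ (by rw [e]; exact hv)
  rw [e] at h1
  rwa [hf a ⟨_, hmem⟩ v (by simp)]

lemma IsAPeriodic.thetaOp {f : Omega Fq → CInf Fq} (hf : IsAPeriodic f) (hh : IsHolomorphic f)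
    (ρ : CInf Fq) (r : ℕ) : IsAPeriodic (thetaOp ρ r f) := by
  intro a z w hw
  obtain ⟨b, hb⟩ := hh.exists_hasTaylor z
  rw [CarlitzTheta.thetaOp, CarlitzTheta.thetaOp, hb.hyperDeriv_eq,
    (hb.translate hf hw).hyperDeriv_eq]

lemma thetaOp_const (ρ : CInf Fq) (r : ℕ) (c : CInf Fq) :
    thetaOp ρ r (fun _ => c) = fun _ => if r = 0 then c else 0 := by
  funext z
  have h : HasTaylor (fun _ : Omega Fq => c) z (fun j => if j = 0 then c else 0) := by
    refine ⟨1, one_pos, fun w _ => ?_⟩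
    convert! hasSum_ite_eq 0 c using 2 with j
    by_cases hj : j = 0 <;> simp [hj]
  rw [thetaOp, h.hyperDeriv_eq]
  rcases eq_or_ne r 0 with rfl | hr <;> simp [*]

end Taylor

/-! ### Uniqueness of expansions at infinity -/

section UExpansion

variable {ρ : CInf Fq}

lemma HasUExpansion.unique (hρ : ρ ^ (qCard Fq - 1) = -theta Fq) {f : Omega Fq → CInf Fq}
    {c c' : (CInf Fq)⟦X⟧} (h : HasUExpansion ρ f c) (h' : HasUExpansion ρ f c') : c = c' := by
  obtain ⟨R, h⟩ := h
  obtain ⟨R', h'⟩ := h'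
  ext n
  rw [← sub_eq_zero]
  refine powerSeries_coeff_eq_zero
    (a := fun n => PowerSeries.coeff n c - PowerSeries.coeff n c') (fun ε hε => ?_) n
  obtain ⟨z, hz, hu⟩ := exists_norm_uParam_lt hρ (max R R') hε
  refine ⟨uParam ρ z, uParam_ne_zero hρ z, hu, ?_⟩
  simpa [sub_mul] using
    (h z ((le_max_left _ _).trans_lt hz)).sub (h' z ((le_max_right _ _).trans_lt hz))

lemma HasUExpansion.uExp_eq (hρ : ρ ^ (qCard Fq - 1) = -theta Fq) {f : Omega Fq → CInf Fq}
    {c : (CInf Fq)⟦X⟧} (h : HasUExpansion ρ f c) : uExp ρ f = c := by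
  have hex : ∃ c, HasUExpansion ρ f c := ⟨c, h⟩
  rw [uExp, dif_pos hex]
  exact hex.choose_spec.unique hρ h

lemma hasUExpansion_const (c : CInf Fq) :
    HasUExpansion ρ (fun _ => c) (PowerSeries.C c) := by
  refine ⟨0, fun z _ => ?_⟩
  convert! hasSum_ite_eq 0 c using 2 with j
  rw [PowerSeries.coeff_C]
  by_cases hj : j = 0 <;> simp [hj]

lemma const_mem_UOmega (c : CInf Fq) : (fun _ => c) ∈ UOmega ρ :=
  ⟨isHolomorphic_const c, fun _ _ _ _ => rfl, _, hasUExpansion_const c⟩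

end UExpansion

end

/-! ## The expansion of `Θ^r(f)` at infinity -/

section

variable {Fq : Type*} [Field Fq] [Fintype Fq]

section ExpSeries

variable {ρ : CInf Fq}

lemma expA_add (hρ : ρ ^ (qCard Fq - 1) = -theta Fq) (x y : CInf Fq) :
    expA ρ (x + y) = expA ρ x + expA ρ y := by
  refine tendsto_nhds_unique (tendsto_eval_linPoly hρ (x + y)) ?_
  have h := (tendsto_eval_linPoly hρ x).add (tendsto_eval_linPoly hρ y)
  refine h.congr fun d => ?_
  simpa [Polynomial.coe_aeval_eq_eval] using (aeval_linPoly_add d x y).symm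

lemma norm_expCoeff_mul_le (hρ : ρ ^ (qCard Fq - 1) = -theta Fq) (i : ℕ) :
    ‖expCoeff ρ i‖ * ‖carlitzPeriod ρ‖ ≤ ‖carlitzPeriod ρ‖ ^ qCard Fq ^ i := by
  rw [norm_expCoeff_mul hρ]
  gcongr
  exact div_le_self (norm_nonneg _) (one_le_pow₀ (one_lt_qCard Fq).le)

lemma norm_coeff_expSeries_mul_le (hρ : ρ ^ (qCard Fq - 1) = -theta Fq) (m : ℕ) :
    ‖PowerSeries.coeff m (expSeries ρ)‖ * ‖carlitzPeriod ρ‖ ≤ ‖carlitzPeriod ρ‖ ^ m := by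
  by_cases hm : ∃ i, qCard Fq ^ i = m
  · obtain ⟨i, rfl⟩ := hm
    rw [expSeries, coeff_qSeries_pow]
    exact norm_expCoeff_mul_le hρ i
  · rw [expSeries, coeff_qSeries_eq_zero _ (not_exists.1 hm), norm_zero, zero_mul]
    positivity

/-- After rescaling `X` by `π̃`, this says that the powers of the Carlitz exponential have
coefficients of norm at most `1`. It controls the triple series in `HasUExpansion.hasTaylor`. -/
lemma norm_coeff_expSeries_pow_mul_le (hρ : ρ ^ (qCard Fq - 1) = -theta Fq) (j m : ℕ) :
    ‖PowerSeries.coeff m (expSeries ρ ^ j)‖ * ‖carlitzPeriod ρ‖ ^ j ≤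
      ‖carlitzPeriod ρ‖ ^ m := by
  have hπ := norm_carlitzPeriod_pos hρ
  induction j generalizing m with
  | zero =>
    rw [pow_zero, PowerSeries.coeff_one]
    split_ifs with h
    · simp [h]
    · simp only [norm_zero, zero_mul]; positivity
  | succ j ih =>
    rw [pow_succ, PowerSeries.coeff_mul, ← le_div_iff₀ (by positivity)]
    refine IsUltrametricDist.norm_sum_le_of_forall_le_of_nonneg (by positivity) fun ab hab => ?_
    rw [le_div_iff₀ (by positivity), norm_mul,
      ← Finset.HasAntidiagonal.mem_antidiagonal.1 hab, pow_succ, pow_add, mul_mul_mul_comm]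
    exact mul_le_mul (ih ab.1) (norm_coeff_expSeries_mul_le hρ ab.2) (by positivity)
      (by positivity)

lemma hasSum_expSeries (hρ : ρ ^ (qCard Fq - 1) = -theta Fq) (x : CInf Fq) :
    HasSum (fun m => PowerSeries.coeff m (expSeries ρ) * x ^ m) (expA ρ x) := by
  refine ((Nat.pow_right_injective (one_lt_qCard_nat (Fq := Fq))).hasSum_iff fun m hm => ?_).1 ?_
  · rw [expSeries, coeff_qSeries_eq_zero _ fun i hi => hm ⟨i, hi⟩, zero_mul]
  · convert! hasSum_expA hρ x using 2 with i
    simp only [Function.comp_apply, expSeries, coeff_qSeries_pow]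

lemma hasSum_expSeries_pow (hρ : ρ ^ (qCard Fq - 1) = -theta Fq) (j : ℕ) (x : CInf Fq) :
    HasSum (fun m => PowerSeries.coeff m (expSeries ρ ^ j) * x ^ m) (expA ρ x ^ j) := by
  have key : ∀ j, HasDiscSeries (fun w => expA ρ w ^ j) 0 (‖x‖ + 1)
      fun m => PowerSeries.coeff m (expSeries ρ ^ j) := by
    intro j
    induction j with
    | zero =>
      intro y _
      simp only [pow_zero]
      convert! hasSum_ite_eq 0 (1 : CInf Fq) using 2 with m
      rw [PowerSeries.coeff_one]
      by_cases hm : m = 0 <;> simp [hm]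
    | succ j ih =>
      have h1 : HasDiscSeries (expA ρ) 0 (‖x‖ + 1)
          fun m => PowerSeries.coeff m (expSeries ρ) := fun y _ => by
        rw [zero_add]; exact hasSum_expSeries hρ y
      simpa only [pow_succ, PowerSeries.coeff_mul] using ih.mul h1
  simpa using key j x (by linarith)

lemma neg_one_pow_qCard : (-1 : CInf Fq) ^ qCard Fq = -1 := by
  rw [← frobQ_apply (Fq := Fq), map_neg, map_one]

lemma neg_one_pow_qCard_pow (i : ℕ) : (-1 : CInf Fq) ^ qCard Fq ^ i = -1 := by
  induction i with
  | zero => simp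
  | succ i ih => rw [pow_succ, pow_mul, ih, neg_one_pow_qCard]

/-- Coefficientwise form of `e_A(-X) ^ j = (-1) ^ j e_A(X) ^ j`: only the exponents `q ^ i` occur in
`e_A`, and `(-1) ^ (q ^ i) = -1` in `ℂ_∞`, also for even `q`. It exchanges the sign of the binomial
series for the sign in `(-π̃) ^ (-r)`. -/
lemma neg_one_pow_mul_coeff_expSeries_pow (r j : ℕ) :
    (-1) ^ r * PowerSeries.coeff r (expSeries ρ ^ j) =
      (-1) ^ j * PowerSeries.coeff r (expSeries ρ ^ j) := by
  induction j generalizing r with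
  | zero =>
    rw [pow_zero, PowerSeries.coeff_one]
    by_cases h : r = 0 <;> simp [h]
  | succ j ih =>
    rw [pow_succ, PowerSeries.coeff_mul, Finset.mul_sum, Finset.mul_sum]
    refine Finset.sum_congr rfl fun ab hab => ?_
    have h : (-1) ^ ab.2 * PowerSeries.coeff ab.2 (expSeries ρ) =
        -1 * PowerSeries.coeff ab.2 (expSeries ρ) := by
      by_cases hm : ∃ i, qCard Fq ^ i = ab.2
      · obtain ⟨i, hi⟩ := hm
        rw [← hi, neg_one_pow_qCard_pow]
      · rw [expSeries, coeff_qSeries_eq_zero _ (not_exists.1 hm), mul_zero, mul_zero]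
    rw [← Finset.HasAntidiagonal.mem_antidiagonal.1 hab, pow_add, pow_succ]
    linear_combination ((-1) ^ ab.2 * PowerSeries.coeff ab.2 (expSeries ρ)) * ih ab.1 +
      ((-1) ^ j * PowerSeries.coeff ab.1 (expSeries ρ ^ j)) * h

lemma norm_period_mul_expA_le (hρ : ρ ^ (qCard Fq - 1) = -theta Fq) {x : CInf Fq}
    (hx : ‖carlitzPeriod ρ‖ * ‖x‖ ≤ 1) : ‖carlitzPeriod ρ * expA ρ x‖ ≤ 1 := by
  refine norm_le_of_hasSum ((hasSum_expA hρ x).mul_left (carlitzPeriod ρ)) zero_le_one fun i => ?_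
  rw [norm_mul, norm_mul, norm_pow]
  calc _ = ‖expCoeff ρ i‖ * ‖carlitzPeriod ρ‖ * ‖x‖ ^ qCard Fq ^ i := by ring
    _ ≤ ‖carlitzPeriod ρ‖ ^ qCard Fq ^ i * ‖x‖ ^ qCard Fq ^ i := by
      gcongr
      exact norm_expCoeff_mul_le hρ i
    _ ≤ 1 := by
      rw [← mul_pow]
      exact pow_le_one₀ (by positivity) hx

lemma uParam_add (hρ : ρ ^ (qCard Fq - 1) = -theta Fq) {z w : Omega Fq} {x : CInf Fq}
    (hw : (w : CInf Fq) = z + x) :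
    uParam ρ w = uParam ρ z / (1 + uParam ρ z * (carlitzPeriod ρ * expA ρ x)) := by
  have h1 := (hasSum_inv_sub_ofA hρ (not_mem_range_ofA z)).1
  have h2 := (hasSum_inv_sub_ofA hρ (not_mem_range_ofA w)).1
  have hπ := carlitzPeriod_ne_zero hρ
  rw [hw, expA_add hρ] at h2
  rw [uParam_eq, uParam_eq, hw, expA_add hρ]
  have h3 : 1 + (carlitzPeriod ρ)⁻¹ * (expA ρ (z : CInf Fq))⁻¹ * (carlitzPeriod ρ * expA ρ x) =
      (expA ρ (z : CInf Fq) + expA ρ x) / expA ρ (z : CInf Fq) := by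
    field_simp
  rw [h3]
  field_simp

end ExpSeries

section Exchange

variable {K : Type*} [NormedField K]

/-- The truncated subtraction is harmless: for `n = 0` the binomial coefficient is `1` at `j = 0`
and `0` afterwards, as the constant function `1` requires. -/
lemma hasSum_choose_neg_pow {y : K} (hy : ‖y‖ < 1) (n : ℕ) :
    HasSum (fun j => (-1) ^ j * ((n + j - 1).choose j : K) * y ^ j) ((1 + y)⁻¹ ^ n) := by
  rcases n with _ | k
  · convert! hasSum_ite_eq 0 (1 : K) using 2 with j
    · rcases j with _ | j
      · simp
      · simp
    · simp
  · have h := hasSum_choose_mul_geometric_of_norm_lt_one k (r := -y) (by rwa [norm_neg])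
    rw [sub_neg_eq_add, one_div, ← inv_pow] at h
    convert! h using 2 with j
    rw [show k + 1 + j - 1 = j + k by omega, Nat.choose_symm_add, neg_pow y]
    ring

lemma tendsto_pow_cofinite_zero {y : K} (hy : ‖y‖ < 1) :
    Tendsto (fun n : ℕ => y ^ n) cofinite (𝓝 0) := by
  rw [Nat.cofinite_eq_atTop]
  exact tendsto_pow_atTop_nhds_zero_of_norm_lt_one hy

end Exchange

section ThetaExpansion

variable {ρ : CInf Fq}

/-- `∑ c_n binom(n + j - 1, j) u ^ (n + j)`. -/
noncomputable def binomShift (j : ℕ) (c : (CInf Fq)⟦X⟧) : (CInf Fq)⟦X⟧ :=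
  PowerSeries.X ^ j * PowerSeries.mk fun n =>
    PowerSeries.coeff n c * ((n + j - 1).choose j : CInf Fq)

/-- The `u`-expansion of `Θ^r(∑ c_n u ^ n)`. -/
noncomputable def thetaSeries (ρ : CInf Fq) (r : ℕ) (c : (CInf Fq)⟦X⟧) : (CInf Fq)⟦X⟧ :=
  ∑ j ∈ Finset.range (r + 1), PowerSeries.C (expPowCoeff ρ r j) * binomShift j c

lemma summable_double {c : (CInf Fq)⟦X⟧} {u : CInf Fq} (hu : ‖u‖ < 1)
    (hc : Summable fun n => PowerSeries.coeff n c * u ^ n) {b : ℕ → CInf Fq} {B : ℝ}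
    (hb : ∀ j, ‖b j‖ ≤ B) :
    Summable fun nj : ℕ × ℕ => PowerSeries.coeff nj.1 c *
      ((-1) ^ nj.2 * ((nj.1 + nj.2 - 1).choose nj.2 : CInf Fq)) * u ^ (nj.1 + nj.2) * b nj.2 := by
  refine NonarchimedeanAddGroup.summable_of_tendsto_cofinite_zero ?_
  have h := (tendsto_mul_cofinite_nhds_zero hc.tendsto_cofinite_zero
    (tendsto_pow_cofinite_zero hu)).norm.mul_const B
  rw [norm_zero, zero_mul] at h
  refine squeeze_zero_norm (fun nj => ?_) h
  rw [pow_add]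
  simp only [norm_mul, norm_pow, norm_neg, norm_one, one_pow, one_mul]
  have h1 := IsUltrametricDist.norm_natCast_le_one (CInf Fq) ((nj.1 + nj.2 - 1).choose nj.2)
  calc _ = ‖PowerSeries.coeff nj.1 c‖ * ‖((nj.1 + nj.2 - 1).choose nj.2 : CInf Fq)‖ *
        (‖u‖ ^ nj.1 * ‖u‖ ^ nj.2) * ‖b nj.2‖ := by ring
    _ ≤ ‖PowerSeries.coeff nj.1 c‖ * 1 * (‖u‖ ^ nj.1 * ‖u‖ ^ nj.2) * B := by
      gcongr
      exact hb _
    _ = _ := by ring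

/-- The transformation `u(z + x) = u / (1 + u π̃ e_A(x))` and the binomial series turn `f(z + x)`
into a triple series over `n`, `j` and the power `m` of `x`. Unconditional convergence permits
regrouping by `m`. -/
lemma HasUExpansion.hasTaylor (hρ : ρ ^ (qCard Fq - 1) = -theta Fq) {f : Omega Fq → CInf Fq}
    {c : (CInf Fq)⟦X⟧} {R : ℝ}
    (h : ∀ z : Omega Fq, R < imagPart (z : CInf Fq) →
      HasSum (fun n : ℕ => PowerSeries.coeff n c * uParam ρ z ^ n) (f z))
    {z : Omega Fq} (hz : R < imagPart (z : CInf Fq)) (hu : ‖uParam ρ z‖ < 1) :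
    HasTaylor f z fun m => ∑' nj : ℕ × ℕ, PowerSeries.coeff nj.1 c *
      ((-1) ^ nj.2 * ((nj.1 + nj.2 - 1).choose nj.2 : CInf Fq)) * uParam ρ z ^ (nj.1 + nj.2) *
        (carlitzPeriod ρ ^ nj.2 * PowerSeries.coeff m (expSeries ρ ^ nj.2)) := by
  have hπ := norm_carlitzPeriod_pos hρ
  -- The first bound preserves the imaginary part, so the `u`-expansion still holds at `w`. The
  -- second gives `|π̃ x| < 1`, which makes the expansion in powers of `x` converge.
  refine ⟨min (imagPart (z : CInf Fq)) ‖carlitzPeriod ρ‖⁻¹,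
    lt_min (imagPart_pos z.2) (inv_pos.2 hπ), fun w hw => ?_⟩
  set x : CInf Fq := (w : CInf Fq) - z with hx
  have hwx : (w : CInf Fq) = z + x := by rw [hx]; ring
  set u := uParam ρ z with hu_def
  have hx1 : ‖x‖ < imagPart (z : CInf Fq) := hw.trans_le (min_le_left _ _)
  have hx2 : ‖carlitzPeriod ρ * x‖ < 1 := by
    rw [norm_mul, ← lt_inv_mul_iff₀ hπ, mul_one]
    exact hw.trans_le (min_le_right _ _)
  have hw' : R < imagPart (w : CInf Fq) := by rw [hwx, imagPart_add hx1]; exact hz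
  have hbound : ∀ m j, ‖carlitzPeriod ρ ^ j * PowerSeries.coeff m (expSeries ρ ^ j)‖ ≤
      ‖carlitzPeriod ρ‖ ^ m := fun m j => by
    rw [norm_mul, norm_pow, mul_comm]; exact norm_coeff_expSeries_pow_mul_le hρ j m
  set T : (ℕ × ℕ) × ℕ → CInf Fq := fun njm => PowerSeries.coeff njm.1.1 c *
      ((-1) ^ njm.1.2 * ((njm.1.1 + njm.1.2 - 1).choose njm.1.2 : CInf Fq)) *
      u ^ (njm.1.1 + njm.1.2) *
      (carlitzPeriod ρ ^ njm.1.2 * PowerSeries.coeff njm.2 (expSeries ρ ^ njm.1.2)) *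
      x ^ njm.2 with hT
  -- The terms are dominated by `|c_n u ^ n| |u| ^ j |π̃ x| ^ m`. Over a complete ultrametric field
  -- it suffices that this tends to zero.
  have hTsum : Summable T := by
    refine NonarchimedeanAddGroup.summable_of_tendsto_cofinite_zero ?_
    have h1 := (tendsto_mul_cofinite_nhds_zero (tendsto_mul_cofinite_nhds_zero
      (h z hz).summable.tendsto_cofinite_zero (tendsto_pow_cofinite_zero hu))
      (tendsto_pow_cofinite_zero hx2)).norm
    rw [norm_zero] at h1
    refine squeeze_zero_norm (fun njm => ?_) h1
    obtain ⟨⟨n, j⟩, m⟩ := njm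
    have h2 := IsUltrametricDist.norm_natCast_le_one (CInf Fq) ((n + j - 1).choose j)
    have h3 := hbound m j
    simp only [hT]
    rw [norm_mul, norm_mul _ (carlitzPeriod ρ ^ j * _), pow_add, mul_pow]
    simp only [norm_mul, norm_pow, norm_neg, norm_one, one_pow, one_mul] at h3 ⊢
    calc _ = ‖PowerSeries.coeff n c‖ * ‖((n + j - 1).choose j : CInf Fq)‖ *
          (‖u‖ ^ n * ‖u‖ ^ j) *
          (‖carlitzPeriod ρ‖ ^ j * ‖PowerSeries.coeff m (expSeries ρ ^ j)‖) * ‖x‖ ^ m := by ring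
      _ ≤ ‖PowerSeries.coeff n c‖ * 1 * (‖u‖ ^ n * ‖u‖ ^ j) *
          ‖carlitzPeriod ρ‖ ^ m * ‖x‖ ^ m := by gcongr
      _ = _ := by ring
  obtain ⟨S, hS⟩ := hTsum
  have hS1 : HasSum (fun nj : ℕ × ℕ => PowerSeries.coeff nj.1 c *
      ((-1) ^ nj.2 * ((nj.1 + nj.2 - 1).choose nj.2 : CInf Fq)) * u ^ (nj.1 + nj.2) *
      (carlitzPeriod ρ ^ nj.2 * expA ρ x ^ nj.2)) S := by
    refine hS.prod_fiberwise fun nj => ?_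
    convert! (hasSum_expSeries_pow hρ nj.2 x).mul_left (PowerSeries.coeff nj.1 c *
      ((-1) ^ nj.2 * ((nj.1 + nj.2 - 1).choose nj.2 : CInf Fq)) * u ^ (nj.1 + nj.2) *
      carlitzPeriod ρ ^ nj.2) using 1
    · funext m
      simp only [hT]
      ring
    · ring
  have hy : ‖u * (carlitzPeriod ρ * expA ρ x)‖ < 1 := by
    rw [norm_mul]
    have := norm_period_mul_expA_le hρ (x := x) (by rw [← norm_mul]; exact hx2.le)
    exact (mul_le_of_le_one_right (norm_nonneg _) this).trans_lt hu
  have hS2 : HasSum (fun n => PowerSeries.coeff n c * uParam ρ w ^ n) S := by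
    refine hS1.prod_fiberwise fun n => ?_
    rw [uParam_add hρ hwx, div_eq_mul_inv, mul_pow, ← mul_assoc]
    convert! (hasSum_choose_neg_pow hy n).mul_left (PowerSeries.coeff n c * u ^ n) using 1
    funext j
    simp only [pow_add, mul_pow]
    ring
  rw [(h w hw').unique hS2]
  -- The same sum `S`, now fibred over the power of `x` rather than over `(n, j)`.
  refine ((Equiv.prodComm ℕ (ℕ × ℕ)).hasSum_iff.2 hS).prod_fiberwise fun m => ?_
  exact ((summable_double hu (h z hz).summable (hbound m)).hasSum).mul_right (x ^ m)

lemma hasSum_binomShift {c : (CInf Fq)⟦X⟧} {u : CInf Fq} (j : ℕ) {s : CInf Fq}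
    (h : HasSum (fun n => PowerSeries.coeff n c * ((n + j - 1).choose j : CInf Fq) *
      u ^ (n + j)) s) :
    HasSum (fun n => PowerSeries.coeff n (binomShift j c) * u ^ n) s := by
  refine ((add_left_injective j).hasSum_iff fun n hn => ?_).1 ?_
  · rw [binomShift, PowerSeries.coeff_X_pow_mul', if_neg, zero_mul]
    exact fun hle => hn ⟨n - j, Nat.sub_add_cancel hle⟩
  · convert! h using 2 with n
    simp [binomShift, PowerSeries.coeff_X_pow_mul']

/-- The `u`-expansion of `Θ^r(f)`. -/
theorem HasUExpansion.thetaOp (hρ : ρ ^ (qCard Fq - 1) = -theta Fq) {f : Omega Fq → CInf Fq}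
    {c : (CInf Fq)⟦X⟧} (h : HasUExpansion ρ f c) (r : ℕ) :
    HasUExpansion ρ (thetaOp ρ r f) (thetaSeries ρ r c) := by
  obtain ⟨R, h⟩ := h
  have hπ := norm_carlitzPeriod_pos hρ
  have hπ0 := carlitzPeriod_ne_zero hρ
  -- The second bound forces `|u(z)| < 1`.
  refine ⟨max R ‖carlitzPeriod ρ‖⁻¹, fun z hz => ?_⟩
  have hz1 := (le_max_left _ _).trans_lt hz
  have hu : ‖uParam ρ z‖ < 1 := by
    refine (norm_uParam_le hρ z).trans_lt ?_
    have h1 := (le_max_right _ _).trans_lt hz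
    rw [← div_eq_mul_inv, div_lt_iff₀ (imagPart_pos z.2), one_mul]
    exact h1
  have hsum := summable_double hu (h z hz1).summable (B := ‖carlitzPeriod ρ‖ ^ r)
    (b := fun j => carlitzPeriod ρ ^ j * PowerSeries.coeff r (expSeries ρ ^ j)) fun j => by
      rw [norm_mul, norm_pow, mul_comm]; exact norm_coeff_expSeries_pow_mul_le hρ j r
  have hS := hsum.hasSum
  have htheta := (HasUExpansion.hasTaylor hρ h hz1 hu).hyperDeriv_eq r
  set u := uParam ρ z
  have hinner : ∀ j, Summable fun n => PowerSeries.coeff n c *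
      ((n + j - 1).choose j : CInf Fq) * u ^ (n + j) := fun j => by
    have h2 := (summable_double hu (h z hz1).summable (B := 1)
      (b := fun j => 1) fun j => by simp).prod_symm.prod_factor j
    convert! h2.mul_left ((-1) ^ j) using 2 with n
    have : ((-1 : CInf Fq) ^ j) * (-1) ^ j = 1 := by rw [← mul_pow]; simp
    simp only [Prod.fst_swap, Prod.snd_swap, mul_one]
    linear_combination (-PowerSeries.coeff n c *
      ((n + j - 1).choose j : CInf Fq) * u ^ (n + j)) * this
  have hS1 := ((Equiv.prodComm ℕ ℕ).hasSum_iff.2 hS).prod_fiberwise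
    (g := fun j => (-1) ^ j * (carlitzPeriod ρ ^ j * PowerSeries.coeff r (expSeries ρ ^ j)) *
      ∑' n, PowerSeries.coeff n c * ((n + j - 1).choose j : CInf Fq) * u ^ (n + j)) fun j => by
    convert! (hinner j).hasSum.mul_left
      ((-1) ^ j * (carlitzPeriod ρ ^ j * PowerSeries.coeff r (expSeries ρ ^ j))) using 2 with n
    simp only [Function.comp_apply, Equiv.prodComm_apply, Prod.fst_swap, Prod.snd_swap]
    ring
  have hS2 : hyperDeriv r f z = ∑ j ∈ Finset.range (r + 1),
      (-1) ^ j * (carlitzPeriod ρ ^ j * PowerSeries.coeff r (expSeries ρ ^ j)) *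
      ∑' n, PowerSeries.coeff n c * ((n + j - 1).choose j : CInf Fq) * u ^ (n + j) := by
    rw [htheta]
    -- The series `e_A(X)` has no constant term, so its `j`-th power does not contribute to `X ^ r`
    -- when `j > r`.
    refine hS1.unique (hasSum_sum_of_ne_finset_zero fun j hj => ?_)
    rw [expSeries, coeff_qSeries_pow_eq_zero _ (by simpa using hj), mul_zero, mul_zero, zero_mul]
  have hval : CarlitzTheta.thetaOp ρ r f z = ∑ j ∈ Finset.range (r + 1), expPowCoeff ρ r j *
      ∑' n, PowerSeries.coeff n c * ((n + j - 1).choose j : CInf Fq) * u ^ (n + j) := by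
    rw [CarlitzTheta.thetaOp, hS2, Finset.mul_sum]
    refine Finset.sum_congr rfl fun j _ => ?_
    rw [← mul_assoc]
    congr 1
    have h3 := neg_one_pow_mul_coeff_expSeries_pow (ρ := ρ) r j
    have h4 : ((-1 : CInf Fq) ^ r) * (-1) ^ r = 1 := by rw [← mul_pow]; simp
    have h5 : 1 / (-carlitzPeriod ρ) ^ r = (-1) ^ r / carlitzPeriod ρ ^ r := by
      rw [neg_pow, div_eq_div_iff (mul_ne_zero (by simp) (pow_ne_zero _ hπ0))
        (pow_ne_zero _ hπ0)]
      linear_combination -(carlitzPeriod ρ ^ r) * h4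
    rw [h5, expPowCoeff]
    linear_combination (-(-1) ^ r * carlitzPeriod ρ ^ j / carlitzPeriod ρ ^ r) * h3 +
      (carlitzPeriod ρ ^ j / carlitzPeriod ρ ^ r *
        PowerSeries.coeff r (expSeries ρ ^ j)) * h4
  rw [hval]
  have hfin := hasSum_sum (s := Finset.range (r + 1)) fun j _ =>
    (hasSum_binomShift j (hinner j).hasSum).mul_left (expPowCoeff ρ r j)
  convert! hfin using 2 with n
  rw [thetaSeries, map_sum, Finset.sum_mul]
  exact Finset.sum_congr rfl fun j _ => by rw [PowerSeries.coeff_C_mul, mul_assoc]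

end ThetaExpansion

end

/-! ## Formal Laurent series -/

section Laurent

variable {F : Type*} [Field F]

lemma coeff_toLaurent_natCast (g : F⟦X⟧) (n : ℕ) :
    (toLaurent g).coeff (n : ℤ) = PowerSeries.coeff n g := by
  rw [toLaurent, LaurentSeries.coeff_coe_powerSeries]

lemma coeff_toLaurent_zero (g : F⟦X⟧) :
    (toLaurent g).coeff 0 = PowerSeries.coeff 0 g := coeff_toLaurent_natCast g 0

lemma coeff_toLaurent_neg (g : F⟦X⟧) {a : ℤ} (ha : a < 0) : (toLaurent g).coeff a = 0 := by
  rw [toLaurent, PowerSeries.coeff_coe, if_pos ha]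

lemma coeff_uPow_mul (m : ℤ) (g : F⸨X⸩) (a : ℤ) : (uPow F m * g).coeff a = g.coeff (a - m) := by
  rw [uPow, HahnSeries.coeff_single_mul, one_mul]

lemma coeff_uPow_mul_hyperDeriv (k m : ℤ) (j : ℕ) (g : F⸨X⸩) (a : ℤ) :
    (uPow F k * formalHyperDeriv j (uPow F m * g)).coeff a =
      Ring.choose (a - k + j) j • g.coeff (a - k + j - m) := by
  rw [coeff_uPow_mul, formalHyperDeriv, LaurentSeries.hasseDeriv_coeff, coeff_uPow_mul]

lemma coeff_toLaurent_X_pow_mul (j : ℕ) (g : F⟦X⟧) (a : ℤ) :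
    (toLaurent (PowerSeries.X ^ j * g)).coeff a = (toLaurent g).coeff (a - j) := by
  rcases lt_or_ge a 0 with ha | ha
  · rw [coeff_toLaurent_neg _ ha, coeff_toLaurent_neg _ (by omega)]
  obtain ⟨n, rfl⟩ := Int.eq_ofNat_of_zero_le ha
  rw [coeff_toLaurent_natCast, PowerSeries.coeff_X_pow_mul']
  split_ifs with h
  · rw [← Nat.cast_sub h, coeff_toLaurent_natCast]
  · rw [coeff_toLaurent_neg _ (by omega)]

/-- A criterion for the `u`-adic convergence of a series of Laurent series. -/
lemma hasSum_laurentSeries {ι : Type*} {f : ι → F⸨X⸩} {s : F⸨X⸩} {T : ℤ → Finset ι}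
    (h : ∀ (a D : ℤ) (S : Finset ι), a < D → T D ⊆ S →
      ∑ n ∈ S, (f n).coeff a = s.coeff a) : HasSum f s := by
  rw [HasSum, SummationFilter.unconditional_filter, tendsto_def]
  intro U hU
  rw [Valued.mem_nhds] at hU
  obtain ⟨γ, hγ⟩ := hU
  set γ₀ := MonoidWithZeroHom.ValueGroup₀.embedding γ.1 with hγ₀
  have hne : γ₀ ≠ 0 := (map_ne_zero _).2 γ.ne_zero
  -- Agreement in all degrees below `1 - log γ₀` bounds the valuation of the difference by `exp (log
  -- γ₀ - 1)`, strictly less than `γ₀`.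
  filter_upwards [eventually_ge_atTop (T (1 - WithZero.log γ₀))] with S hS
  refine hγ ?_
  rw [Set.mem_ofPred_eq, Valuation.restrict_lt_iff_lt_embedding]
  refine lt_of_le_of_lt
    ((LaurentSeries.valuation_le_iff_coeff_lt_eq_zero F (D := 1 - WithZero.log γ₀)).2 ?_) ?_
  · intro a ha
    rw [HahnSeries.coeff_sub, HahnSeries.coeff_sum, h a _ S ha hS, sub_self]
  · rw [← hγ₀, ← WithZero.lt_log_iff_exp_lt hne]
    omega

end Laurent

/-! ### The two formulas, coefficient by coefficient -/

section Formulas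

variable {Fq : Type*} [Field Fq] [Fintype Fq] {ρ : CInf Fq}

lemma uPow_mul_hyperDeriv_toLaurent (j : ℕ) (c : (CInf Fq)⟦X⟧) :
    uPow (CInf Fq) ((j : ℤ) + 1) *
        formalHyperDeriv j (uPow (CInf Fq) ((j : ℤ) - 1) * toLaurent c) =
      toLaurent (binomShift j c) := by
  ext a
  rw [coeff_uPow_mul_hyperDeriv, binomShift, coeff_toLaurent_X_pow_mul,
    show a - ((j : ℤ) + 1) + j - (j - 1) = a - j by ring,
    show a - ((j : ℤ) + 1) + j = a - 1 by ring]
  rcases lt_or_ge (a - j) 0 with ha | ha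
  · rw [coeff_toLaurent_neg _ ha, coeff_toLaurent_neg _ ha, smul_zero]
  obtain ⟨n, hn⟩ := Int.eq_ofNat_of_zero_le ha
  rw [hn, coeff_toLaurent_natCast, coeff_toLaurent_natCast, PowerSeries.coeff_mk]
  -- For `n = j = 0` the integer upper index is `-1` while the natural one is truncated to `0`; both
  -- binomial coefficients are `1` because the lower index is `0`.
  rcases Nat.eq_zero_or_pos (n + j) with h0 | hpos
  · obtain ⟨rfl, rfl⟩ : n = 0 ∧ j = 0 := by omega
    simp
  · have : a - 1 = ((n + j - 1 : ℕ) : ℤ) := by omega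
    rw [this, Ring.choose_natCast]
    simp [mul_comm]

lemma toLaurent_thetaSeries (r : ℕ) (c : (CInf Fq)⟦X⟧) :
    toLaurent (thetaSeries ρ r c) = ∑ j ∈ Finset.range (r + 1), expPowCoeff ρ r j •
      (uPow (CInf Fq) ((j : ℤ) + 1) *
        formalHyperDeriv j (uPow (CInf Fq) ((j : ℤ) - 1) * toLaurent c)) := by
  simp only [uPow_mul_hyperDeriv_toLaurent]
  simp only [thetaSeries, toLaurent, map_sum]
  refine Finset.sum_congr rfl fun j _ => ?_
  rw [← PowerSeries.smul_eq_C_mul]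
  exact PowerSeries.coe_smul (R := CInf Fq) (S := CInf Fq) (r := expPowCoeff ρ r j) (x := binomShift j c)

/-- With `n + j = m + 1` the binomial coefficient is `binom(m, j)`. The range can be changed from `j
≤ r` to `j ≤ m`, as `β_{r,j} = 0` for `j > r` and `binom(m, j) = 0` for `j > m`. In this form `r` no
longer bounds the sum, which is what the first formula needs. -/
lemma coeff_thetaSeries (r : ℕ) (c : (CInf Fq)⟦X⟧) (m : ℕ) :
    PowerSeries.coeff (m + 1) (thetaSeries ρ r c) = ∑ j ∈ Finset.range (m + 1),
      PowerSeries.coeff (m + 1 - j) c * ((m.choose j : CInf Fq) * expPowCoeff ρ r j) := by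
  have hzero : ∀ j, r < j → expPowCoeff ρ r j = 0 := fun j hj => by
    rw [expPowCoeff, expSeries, coeff_qSeries_pow_eq_zero _ hj, mul_zero]
  have hterm : ∀ j, PowerSeries.coeff (m + 1)
      (PowerSeries.C (expPowCoeff ρ r j) * binomShift j c) =
      PowerSeries.coeff (m + 1 - j) c * ((m.choose j : CInf Fq) * expPowCoeff ρ r j) := by
    intro j
    rw [PowerSeries.coeff_C_mul, binomShift, PowerSeries.coeff_X_pow_mul']
    split_ifs with h
    · rw [PowerSeries.coeff_mk, show m + 1 - j + j - 1 = m by omega]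
      ring
    · rw [Nat.choose_eq_zero_of_lt (by omega)]
      simp
  rw [thetaSeries, map_sum, Finset.sum_congr rfl fun j _ => hterm j]
  rcases le_total r m with h | h
  · refine Finset.sum_subset (Finset.range_mono (by omega)) fun j _ hj => ?_
    rw [hzero j (by simpa using hj), mul_zero, mul_zero]
  · refine (Finset.sum_subset (Finset.range_mono (by omega)) fun j _ hj => ?_).symm
    rw [Nat.choose_eq_zero_of_lt (by simpa using hj)]
    simp

lemma coeff_zero_thetaSeries (r : ℕ) (c : (CInf Fq)⟦X⟧) :
    PowerSeries.coeff 0 (thetaSeries ρ r c) = if r = 0 then PowerSeries.coeff 0 c else 0 := by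
  rw [thetaSeries, map_sum, Finset.sum_eq_single_of_mem 0 (by simp)]
  · simp only [binomShift, expPowCoeff, PowerSeries.coeff_C_mul, pow_zero, one_mul,
      PowerSeries.coeff_mk, PowerSeries.coeff_one]
    split_ifs with h <;> simp [h]
  · intro j _ hj
    rw [PowerSeries.coeff_C_mul, binomShift, PowerSeries.coeff_X_pow_mul', if_neg (by omega),
      mul_zero]

lemma coeff_zero_carlitzGoss (r : ℕ) : (carlitzGoss ρ r).coeff 0 = 0 := by
  rw [carlitzGoss, Polynomial.finsetSum_coeff]
  exact Finset.sum_eq_zero fun j _ => by simp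

/-- In degree `a = m + 1` the `n`-th term meets the coefficient `β_{r,j}` with `j = m + 1 - n`, and
`binom(m, n - 1) = binom(m, j)` matches `coeff_thetaSeries`. Terms with `n > a` vanish since the
Goss polynomial has no constant term, so any finite set containing all `n ≤ a` gives the full
coefficient. -/
lemma sum_coeff_hyperDeriv_carlitzGoss (r : ℕ) (c : (CInf Fq)⟦X⟧) (a : ℤ) (S : Finset ℕ+)
    (hS : ∀ n : ℕ+, ((n : ℕ) : ℤ) ≤ a → n ∈ S) :
    ∑ n ∈ S, (PowerSeries.coeff (n : ℕ) c • (uPow (CInf Fq) ((n : ℕ) : ℤ) *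
      formalHyperDeriv ((n : ℕ) - 1) (uPow (CInf Fq) (((n : ℕ) : ℤ) - 2) *
        toLaurent (carlitzGoss ρ r : (CInf Fq)⟦X⟧)))).coeff a =
    (toLaurent (thetaSeries ρ r c) -
      toLaurent (PowerSeries.C (if r = 0 then PowerSeries.coeff 0 c else 0))).coeff a := by
  have hterm : ∀ n : ℕ+, (PowerSeries.coeff (n : ℕ) c • (uPow (CInf Fq) ((n : ℕ) : ℤ) *
      formalHyperDeriv ((n : ℕ) - 1) (uPow (CInf Fq) (((n : ℕ) : ℤ) - 2) *
        toLaurent (carlitzGoss ρ r : (CInf Fq)⟦X⟧)))).coeff a =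
      PowerSeries.coeff (n : ℕ) c * (Ring.choose (a - 1) ((n : ℕ) - 1) •
        (toLaurent (carlitzGoss ρ r : (CInf Fq)⟦X⟧)).coeff (a - (n : ℕ) + 1)) := fun n => by
    have h1 := n.pos
    rw [HahnSeries.coeff_smul, coeff_uPow_mul_hyperDeriv, smul_eq_mul]
    congr 3
    · omega
    · omega
  have hsmall : ∀ n : ℕ+, a < (n : ℕ) →
      (toLaurent (carlitzGoss ρ r : (CInf Fq)⟦X⟧)).coeff (a - (n : ℕ) + 1) = 0 := fun n hn => by
    rcases lt_or_eq_of_le (by omega : a - (n : ℕ) + 1 ≤ 0) with h | h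
    · exact coeff_toLaurent_neg _ h
    · rw [h, coeff_toLaurent_zero, Polynomial.coeff_coe,
        coeff_zero_carlitzGoss]
  simp only [hterm]
  rw [HahnSeries.coeff_sub]
  rcases lt_or_ge a 1 with ha | ha
  · rw [Finset.sum_eq_zero fun n _ => by
      rw [hsmall n (by have := n.pos; omega), smul_zero, mul_zero]]
    rcases lt_or_eq_of_le (by omega : a ≤ 0) with h | rfl
    · rw [coeff_toLaurent_neg _ h, coeff_toLaurent_neg _ h, sub_zero]
    · rw [coeff_toLaurent_zero, coeff_toLaurent_zero,
        coeff_zero_thetaSeries, PowerSeries.coeff_zero_C, sub_self]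
  · obtain ⟨m, rfl⟩ : ∃ m : ℕ, a = ((m + 1 : ℕ) : ℤ) := ⟨(a - 1).toNat, by omega⟩
    rw [coeff_toLaurent_natCast, coeff_toLaurent_natCast, coeff_thetaSeries,
      PowerSeries.coeff_C, if_neg (Nat.succ_ne_zero m), sub_zero]
    -- The substitution is `n = m - j + 1`; indices of `S` outside its image exceed `m + 1` and
    -- contribute nothing.
    refine (Finset.sum_of_injOn (fun j : ℕ => Nat.succPNat (m - j)) ?_ ?_ ?_ ?_).symm
    · intro i hi j hj hij
      have := congrArg PNat.val hij
      simp only [Finset.coe_range, Set.mem_Iio] at hi hj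
      simp only [Nat.succPNat_coe] at this
      omega
    · intro j hj
      refine hS _ ?_
      rw [Nat.succPNat_coe]
      omega
    · intro n _ hn
      rw [hsmall n, smul_zero, mul_zero]
      by_contra! hle
      have h1 := n.pos
      refine hn ⟨m - PNat.natPred n, ?_, ?_⟩
      · simp only [Finset.coe_range, Set.mem_Iio]; omega
      · have h2 := PNat.natPred_add_one n
        dsimp only
        rw [show m - (m - PNat.natPred n) = PNat.natPred n by omega, PNat.succPNat_natPred]
    · intro j hj
      have hj' : j < m + 1 := Finset.mem_range.1 hj
      have e1 : ((m + 1 : ℕ) : ℤ) - 1 = (m : ℕ) := by omega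
      have e2 : ((m + 1 : ℕ) : ℤ) - ((m - j + 1 : ℕ) : ℤ) + 1 = ((j + 1 : ℕ) : ℤ) := by omega
      simp only [Nat.succPNat_coe, Nat.succ_eq_add_one]
      rw [e1, e2, coeff_toLaurent_natCast, Polynomial.coeff_coe, coeff_carlitzGoss,
        Ring.choose_natCast, Nat.add_sub_cancel, Nat.choose_symm (by omega),
        show m + 1 - j = m - j + 1 by omega]
      simp

end Formulas

end CarlitzTheta

open CarlitzTheta in
/-- Infinite sums of formal Laurent series are taken in the `u`-adic topology, which is the
topology that Mathlib puts on Laurent series over a field. -/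
theorem corollaryC {Fq : Type*} [Field Fq] [Fintype Fq]
    (ρ : CInf Fq) (hρ : ρ ^ (Fintype.card Fq - 1) = -theta Fq)
    (f : Omega Fq → CInf Fq) (hf : f ∈ UOmega ρ) (r : ℕ) :
    -- both functions of which the `u`-expansion is taken below have one
    thetaOp ρ r f ∈ UOmega ρ ∧
    thetaOp ρ r (fun _ => PowerSeries.coeff 0 (uExp ρ f)) ∈ UOmega ρ ∧
    -- first formula, with `c_n = PowerSeries.coeff n (uExp ρ f)`
    HasSum
      (fun n : ℕ+ => PowerSeries.coeff (n : ℕ) (uExp ρ f) •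
        (uPow (CInf Fq) (n : ℤ) *
          formalHyperDeriv ((n : ℕ) - 1)
            (uPow (CInf Fq) ((n : ℤ) - 2) *
              toLaurent (gossPoly (carlitzLattice ρ) (r + 1) : PowerSeries (CInf Fq)))))
      (toLaurent (uExp ρ (thetaOp ρ r f)) -
        toLaurent (uExp ρ (thetaOp ρ r (fun _ => PowerSeries.coeff 0 (uExp ρ f))))) ∧
    -- second formula
    toLaurent (uExp ρ (thetaOp ρ r f)) =
      ∑ j ∈ Finset.range (r + 1), gossCoeff ρ r j •
        (uPow (CInf Fq) ((j : ℤ) + 1) *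
          formalHyperDeriv j (uPow (CInf Fq) ((j : ℤ) - 1) * toLaurent (uExp ρ f))) := by
  obtain ⟨hhol, hper, c, hc⟩ := hf
  have hθ := hc.thetaOp hρ r
  rw [hc.uExp_eq hρ, hθ.uExp_eq hρ, thetaOp_const, (hasUExpansion_const _).uExp_eq hρ,
    gossPoly_carlitzLattice hρ]
  refine ⟨⟨hhol.thetaOp ρ r, hper.thetaOp hhol ρ r, _, hθ⟩, const_mem_UOmega _, ?_, ?_⟩
  -- The set `T D` consists of the positive integers up to `D`, which contains every `n ≤ a` for `a
  -- < D`.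
  · refine hasSum_laurentSeries
      (T := fun D => (Finset.range D.toNat).image Nat.succPNat) fun a D S ha hS => ?_
    refine sum_coeff_hyperDeriv_carlitzGoss r c a S fun n hn => hS ?_
    refine Finset.mem_image.2 ⟨PNat.natPred n, ?_, PNat.succPNat_natPred n⟩
    have := PNat.natPred_add_one n
    rw [Finset.mem_range]
    omega
  · simp only [gossCoeff_eq hρ]
    exact toLaurent_thetaSeries r c
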